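/- Let $K$ be an algebraically closed field of arbitrary characteristic, $n\ge 1$, $K[[\mathbf x]]=K[[x_1,\dots,x_n]]$ with maximal ideal $\mathfrak m$, and $f\in K[[\mathbf x]]$ a power series of multiplicity (order) $m$. Let $j(f)$ be the ideal generated by the partial derivatives of $f$, $\mu(f)=\dim_K K[[\mathbf x]]/j(f)$ and $\tau(f)=\dim_K K[[\mathbf x]]/(\langle f\rangle+j(f))$. Let either $G=\mathcal R=\mathrm{Aut}_K(K[[\mathbf x]])$, the right group, and assume $\mu(f)<\infty$; or $G=\mathcal K=K[[\mathbf x]]^*\rtimes \mathrm{Aut}_K(K[[\mathbf x]])$, the contact group, acting by $(u,\Phi)\cdot g=u\,\Phi(g)$, and assume $\tau(f)<\infty$. Then $$G\text{-}\mathrm{mod}(f)\ \ge\ \binom{n+m-1}{m}-n^2 .$$ In particular, (i) if $n=2$, then $G\text{-}\mathrm{mod}(f)\ge m-3$; (ii) if $n\ge 3$ and $m\ge 3$, then $G\text{-}\mathrm{mod}(f)\ge \frac{m^2+3m-16}{2}$. Here $G\text{-}\mathrm{mod}(f)$ is the modality of the $k$-jet $j^kf$ in $J_k=K[[\mathbf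 x]]/\mathfrak m^{k+1}$ (an affine space with its Zariski topology) under the action of the algebraic group $G_k$ of $k$-jets of elements of $G$, for any sufficiently large $k$, that is, any $k$ for which there is a neighbourhood $U$ of $j^kf$ in $J_k$ such that, whenever $j^kg\in U$ and $j^kh=j^kg$, the series $h$ lies in the $G$-orbit of $g$. The modality of a point $x\in J_k$ is $\min_U\max_i\dim p_i(U\cap X_i)$, where $U$ runs over the open neighbourhoods of $x$ and $X_1,\dots,X_s$ is any Rosenlicht stratification, i.e. a finite decomposition of $J_k$ into disjoint $G_k$-invariant locally closed subvarieties having geometric quotients $p_i:X_i\to X_i/G_k$. The bounds hold equally when the modality is computed as the number of $G$-parameters $\min_U\max_{i\ge 0}(\dim U(i)-i)$, with $U(i)=\{y\in U:\dim_y(U\cap G_k\cdot y)=i\}$, where $\dim_y W$ is the maximal dimension of an irreducible component of $W$ containing $y$. -/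

import Mathlib

noncomputable section

/-! ### Zariski topology, regular functions, dimension

Varieties over the algebraically closed field `K` are described by their closed points. -/

/-- The polynomial functions on a finite-dimensional vector space `V` (an affine space): the
algebra of functions generated by the linear forms. -/
def polyFun (K V : Type*) [Field K] [AddCommGroup V] [Module K V] : Subalgebra K (V → K) :=
  Algebra.adjoin K (Set.range fun l : Module.Dual K V => (l : V → K))

/-- The Zariski topology on a finite-dimensional vector space: the sets `{p ≠ 0}`, for `p` a
polynomial function, form a basis. -/
@[reducible] def zariski (K V : Type*) [Field K] [AddCommGroup V] [Module K V] : TopologicalSpace V :=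
  TopologicalSpace.generateFrom {U | ∃ p ∈ polyFun K V, U = {v | p v ≠ 0}}

/-- For a subset `S` of the affine space `V` (with inclusion `e : S → V`) and `O ⊆ S`: the
function `φ` is, locally on `O`, a quotient of polynomial functions. -/
def IsRegularOn (K : Type*) {V S : Type*} [Field K] [AddCommGroup V] [Module K V]
    (e : S → V) (O : Set S) (φ : S → K) : Prop :=
  ∀ y ∈ O, ∃ p ∈ polyFun K V, ∃ q ∈ polyFun K V, q (e y) ≠ 0 ∧
    ∀ z ∈ O, q (e z) ≠ 0 → φ z = p (e z) / q (e z)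

/-- Inclusion of the possible values of a dimension (`⊥` for the empty set) in `EReal`. -/
def dimToEReal (d : WithBot ℕ∞) : EReal :=
  WithBot.recBotCoe ⊥ (fun e : ℕ∞ => ((e : ENNReal) : EReal)) d

/-- The dimension of a constructible subset `S` of a variety `X`, i.e. the Krull dimension of
its Zariski closure. -/
def setDim {X : Type*} [TopologicalSpace X] (S : Set X) : EReal :=
  dimToEReal (topologicalKrullDim (closure S))

/-- `dim_x W`: the maximal dimension of an irreducible component of `W` containing `x`. -/
def dimAt {X : Type*} [TopologicalSpace X] (W : Set X) (x : X) : EReal :=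
  ⨆ Z ∈ {Z : Set W | Z ∈ irreducibleComponents W ∧ x ∈ Subtype.val '' Z},
    setDim (Subtype.val '' Z)

/-! ### The number of `G`-parameters -/

/-- `U(i)`: the points `y ∈ U` with `dim_y (U ∩ G y) = i`. -/
def orbitDimSet (G : Type*) {X : Type*} [TopologicalSpace X] [Group G] [MulAction G X]
    (U : Set X) (i : ℕ) : Set X :=
  {y | y ∈ U ∧ dimAt (U ∩ MulAction.orbit G y) y = ((i : ℝ) : EReal)}

/-- `G-par(U) = max_i (dim U(i) - i)`. -/
def gParOn (G : Type*) {X : Type*} [TopologicalSpace X] [Group G] [MulAction G X]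
    (U : Set X) : EReal :=
  ⨆ i : ℕ, (setDim (orbitDimSet G U i) - ((i : ℝ) : EReal))

/-- `G-par(x)`, the minimum of `G-par(U)` over the open neighbourhoods `U` of `x`. -/
def gPar (G : Type*) {X : Type*} [TopologicalSpace X] [Group G] [MulAction G X]
    (x : X) : EReal :=
  ⨅ U ∈ {U : Set X | IsOpen U ∧ x ∈ U}, gParOn G U

/-! ### Jet spaces -/

/-- The jet space `J_k = K[[x_1, …, x_n]] / 𝔪 ^ (k + 1)`. -/
def JetSpace (n : ℕ) (K : Type*) [Field K] (k : ℕ) : Type _ :=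
  MvPowerSeries (Fin n) K ⧸ (IsLocalRing.maximalIdeal (MvPowerSeries (Fin n) K)) ^ (k + 1)

instance (n : ℕ) (K : Type*) [Field K] (k : ℕ) : CommRing (JetSpace n K k) :=
  inferInstanceAs (CommRing (MvPowerSeries (Fin n) K ⧸
    (IsLocalRing.maximalIdeal (MvPowerSeries (Fin n) K)) ^ (k + 1)))

instance (n : ℕ) (K : Type*) [Field K] (k : ℕ) : Algebra K (JetSpace n K k) :=
  inferInstanceAs (Algebra K (MvPowerSeries (Fin n) K ⧸
    (IsLocalRing.maximalIdeal (MvPowerSeries (Fin n) K)) ^ (k + 1)))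

/-- `J_k` is an affine space over `K`, with its Zariski topology. -/
instance (n : ℕ) (K : Type*) [Field K] (k : ℕ) : TopologicalSpace (JetSpace n K k) :=
  zariski K (JetSpace n K k)

/-- The `k`-jet `j^k f`. -/
def jet {n : ℕ} {K : Type*} [Field K] (k : ℕ) : MvPowerSeries (Fin n) K →ₐ[K] JetSpace n K k :=
  Ideal.Quotient.mkₐ K ((IsLocalRing.maximalIdeal (MvPowerSeries (Fin n) K)) ^ (k + 1))

theorem jet_surjective {n : ℕ} {K : Type*} [Field K] (k : ℕ) :
    Function.Surjective (jet (n := n) (K := K) k) :=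
  Ideal.Quotient.mkₐ_surjective _ _

theorem jet_eq_jet_iff {n : ℕ} {K : Type*} [Field K] {k : ℕ} {f g : MvPowerSeries (Fin n) K} :
    jet k f = jet k g ↔
      f - g ∈ (IsLocalRing.maximalIdeal (MvPowerSeries (Fin n) K)) ^ (k + 1) :=
  Ideal.Quotient.eq

/-! ### The right group and the contact group -/

/-- The right group: the `K`-algebra automorphisms of `K[[x_1, …, x_n]]`. It acts on power series
by evaluation. -/
abbrev RightGroup (n : ℕ) (K : Type*) [Field K] : Type _ :=
  MvPowerSeries (Fin n) K ≃ₐ[K] MvPowerSeries (Fin n) K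

/-- The action of the right group on the units of `K[[x_1, …, x_n]]`. -/
def rightOnUnits (n : ℕ) (K : Type*) [Field K] :
    RightGroup n K →* MulAut (MvPowerSeries (Fin n) K)ˣ where
  toFun Φ := Units.mapEquiv (Φ : MvPowerSeries (Fin n) K ≃* MvPowerSeries (Fin n) K)
  map_one' := by ext u; rfl
  map_mul' Φ Ψ := by ext u; rfl

/-- The contact group: the semidirect product of the units of `K[[x_1, …, x_n]]` with the right
group. -/
abbrev ContactGroup (n : ℕ) (K : Type*) [Field K] : Type _ :=
  (MvPowerSeries (Fin n) K)ˣ ⋊[rightOnUnits n K] RightGroup n K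

/-- The contact group acts on power series by `(u, Φ) • f = u * Φ f`. -/
instance contactAction (n : ℕ) (K : Type*) [Field K] :
    MulAction (ContactGroup n K) (MvPowerSeries (Fin n) K) where
  smul g f := (g.left : MvPowerSeries (Fin n) K) * g.right f
  one_smul f := by
    change ((1 : (MvPowerSeries (Fin n) K)ˣ) : MvPowerSeries (Fin n) K) * f = f
    simp
  mul_smul g h f := by
    change ((g.left * rightOnUnits n K g.right h.left : (MvPowerSeries (Fin n) K)ˣ) :
        MvPowerSeries (Fin n) K) * g.right (h.right f) =
      (g.left : MvPowerSeries (Fin n) K) *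
        g.right ((h.left : MvPowerSeries (Fin n) K) * h.right f)
    rw [Units.val_mul, map_mul, mul_assoc]
    rfl

theorem right_mem_pow {n : ℕ} {K : Type*} [Field K] (Φ : RightGroup n K) (k : ℕ)
    {f : MvPowerSeries (Fin n) K}
    (hf : f ∈ (IsLocalRing.maximalIdeal (MvPowerSeries (Fin n) K)) ^ k) :
    Φ f ∈ (IsLocalRing.maximalIdeal (MvPowerSeries (Fin n) K)) ^ k := by
  have h : (IsLocalRing.maximalIdeal (MvPowerSeries (Fin n) K)) ≤
      (IsLocalRing.maximalIdeal (MvPowerSeries (Fin n) K)).comap Φ := by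
    intro a ha
    rw [Ideal.mem_comap, IsLocalRing.mem_maximalIdeal, mem_nonunits_iff]
    rw [IsLocalRing.mem_maximalIdeal, mem_nonunits_iff] at ha
    exact fun hu => ha ((MulEquiv.isUnit_map Φ).1 hu)
  exact (Ideal.le_comap_pow Φ k) (Ideal.pow_right_mono h k hf)

/-- The action of the right group on `J_k`, characterised by `Φ • j^k f = j^k (Φ f)`. It factors
through the group of `k`-jets of automorphisms, and has the same orbits as that algebraic group. -/
instance rightJetAction (n : ℕ) (K : Type*) [Field K] (k : ℕ) :
    MulAction (RightGroup n K) (JetSpace n K k) where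
  smul Φ a := Ideal.quotientMap
    ((IsLocalRing.maximalIdeal (MvPowerSeries (Fin n) K)) ^ (k + 1))
    (Φ : MvPowerSeries (Fin n) K →+* MvPowerSeries (Fin n) K)
    (fun _ hf => right_mem_pow Φ (k + 1) hf) a
  one_smul a := by obtain ⟨f, rfl⟩ := jet_surjective k a; rfl
  mul_smul Φ Ψ a := by obtain ⟨f, rfl⟩ := jet_surjective k a; rfl

theorem right_smul_jet {n : ℕ} {K : Type*} [Field K] (k : ℕ) (Φ : RightGroup n K)
    (f : MvPowerSeries (Fin n) K) : Φ • jet k f = jet k (Φ • f) := rfl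

/-- The action of the contact group on `J_k`, characterised by
`(u, Φ) • j^k f = j^k (u * Φ f)`. It factors through the group of `k`-jets of contact
transformations, and has the same orbits as that algebraic group. -/
instance contactJetAction (n : ℕ) (K : Type*) [Field K] (k : ℕ) :
    MulAction (ContactGroup n K) (JetSpace n K k) where
  smul g a := jet k (g.left : MvPowerSeries (Fin n) K) * (g.right • a)
  one_smul a := by
    obtain ⟨f, rfl⟩ := jet_surjective k a
    change jet k _ * jet k _ = jet k _
    rw [← map_mul]
    exact congrArg (jet k) (one_smul (ContactGroup n K) f)
  mul_smul g h a := by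
    obtain ⟨f, rfl⟩ := jet_surjective k a
    change jet k _ * jet k _ = jet k _ * (g.right • (jet k _ * jet k _))
    rw [← map_mul, ← map_mul, right_smul_jet, ← map_mul]
    exact congrArg (jet k) (mul_smul g h f)

theorem contact_smul_jet {n : ℕ} {K : Type*} [Field K] (k : ℕ) (g : ContactGroup n K)
    (f : MvPowerSeries (Fin n) K) : g • jet k f = jet k (g • f) :=
  (map_mul (jet k) _ _).symm

/-! ### Rosenlicht stratifications and modality

`P` is a `G`-invariant subset of `J_k`. The orbit space `P / G` carries the quotient topology, and
its regular functions on an open set `O` are the functions whose pullbacks to the preimage of `O`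
in `P` are regular, i.e. they correspond to the invariant regular functions there. `P / G` is a
geometric quotient if this makes it an algebraic variety. -/

/-- The projection `P → P / G`. -/
def quotProj {n : ℕ} {K : Type*} [Field K] {k : ℕ} {G : Type*} [Group G]
    [MulAction G (JetSpace n K k)] (P : SubMulAction G (JetSpace n K k)) (x : P) :
    MulAction.orbitRel.Quotient G P :=
  Quotient.mk (MulAction.orbitRel G P) x

/-- `ψ` maps the open subset `W` of `P / G` isomorphically, as spaces with regular functions,
onto a Zariski closed subset of the affine space `K^N`. -/
structure IsAffineChart {n : ℕ} {K : Type*} [Field K] {k : ℕ} {G : Type*} [Group G]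
    [MulAction G (JetSpace n K k)] (P : SubMulAction G (JetSpace n K k))
    (W : Set (MulAction.orbitRel.Quotient G P)) (N : ℕ)
    (ψ : MulAction.orbitRel.Quotient G P → (Fin N → K)) : Prop where
  isOpen : IsOpen W
  isClosedEmbedding : @Topology.IsClosedEmbedding W (Fin N → K) _ (zariski K (Fin N → K))
    (W.domRestrict ψ)
  regular_iff : ∀ (B : Set (Fin N → K)) (φ : (Fin N → K) → K),
    @IsOpen (Fin N → K) (zariski K (Fin N → K)) B →
      (IsRegularOn K (id : (Fin N → K) → (Fin N → K)) (ψ '' W ∩ B) φ ↔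
        IsRegularOn K (Subtype.val : P → JetSpace n K k) (quotProj P ⁻¹' (W ∩ ψ ⁻¹' B))
          (φ ∘ ψ ∘ quotProj P))

/-- `P / G` is an algebraic variety: it is covered by affine open sets and it is separated, i.e.
the diagonal is closed in each product of two affine open sets. (Finitely many affine open sets
suffice, since `P` is a Noetherian space.) -/
structure IsGeometricQuotient {n : ℕ} {K : Type*} [Field K] {k : ℕ} {G : Type*} [Group G]
    [MulAction G (JetSpace n K k)] (P : SubMulAction G (JetSpace n K k)) : Prop where
  exists_chart : ∀ y : MulAction.orbitRel.Quotient G P, ∃ W N ψ, y ∈ W ∧ IsAffineChart P W N ψ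
  separated : ∀ W N ψ W' N' ψ', IsAffineChart P W N ψ → IsAffineChart P W' N' ψ' →
    @IsClosed ((Fin N → K) × (Fin N' → K)) (zariski K ((Fin N → K) × (Fin N' → K)))
      ((fun y => (ψ y, ψ' y)) '' (W ∩ W'))

/-- A Rosenlicht stratification of `J_k`: a finite decomposition into disjoint `G`-invariant
locally closed subvarieties whose orbit spaces are geometric quotients. -/
structure RosenlichtStratification (n : ℕ) (K : Type*) [Field K] (k : ℕ) (G : Type*) [Group G]
    [MulAction G (JetSpace n K k)] where
  s : ℕ
  piece : Fin s → SubMulAction G (JetSpace n K k)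
  isLocallyClosed : ∀ i, IsLocallyClosed (piece i : Set (JetSpace n K k))
  disjoint : Pairwise fun i j =>
    Disjoint (piece i : Set (JetSpace n K k)) (piece j : Set (JetSpace n K k))
  cover : ⋃ i, (piece i : Set (JetSpace n K k)) = Set.univ
  isGeometricQuotient : ∀ i, IsGeometricQuotient (piece i)

/-- `G-mod(U) = max_i dim p_i (U ∩ X_i)`. -/
def gModOn {n : ℕ} {K : Type*} [Field K] {k : ℕ} {G : Type*} [Group G]
    [MulAction G (JetSpace n K k)] (S : RosenlichtStratification n K k G)
    (U : Set (JetSpace n K k)) : EReal :=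
  ⨆ i, setDim (quotProj (S.piece i) '' (Subtype.val ⁻¹' U))

/-- `G-mod(x)`, the minimum of `G-mod(U)` over the open neighbourhoods `U` of `x`. -/
def gMod {n : ℕ} {K : Type*} [Field K] {k : ℕ} {G : Type*} [Group G]
    [MulAction G (JetSpace n K k)] (S : RosenlichtStratification n K k G)
    (x : JetSpace n K k) : EReal :=
  ⨅ U ∈ {U : Set (JetSpace n K k) | IsOpen U ∧ x ∈ U}, gModOn S U

/-- `d` is the `G`-modality of the jet `x`, computed either from a Rosenlicht stratification or as
the number of `G`-parameters. -/
def IsJetModality {n : ℕ} {K : Type*} [Field K] {k : ℕ} (G : Type*) [Group G]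
    [MulAction G (JetSpace n K k)] (x : JetSpace n K k) (d : EReal) : Prop :=
  (∃ S : RosenlichtStratification n K k G, d = gMod S x) ∨ d = gPar G x

/-! ### Modality of power series -/

/-- `g` is `k`-determined with respect to `G`. -/
def IsDetermined {n : ℕ} {K : Type*} [Field K] (G : Type*) [Group G]
    [MulAction G (MvPowerSeries (Fin n) K)] (k : ℕ) (g : MvPowerSeries (Fin n) K) : Prop :=
  ∀ h : MvPowerSeries (Fin n) K, jet k h = jet k g → h ∈ MulAction.orbit G g

/-- `k` is sufficiently large for `f` with respect to `G`: all power series whose `k`-jets are in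
some neighbourhood of `j^k f` are `k`-determined. -/
def IsSufficientlyLarge {n : ℕ} {K : Type*} [Field K] (G : Type*) [Group G]
    [MulAction G (MvPowerSeries (Fin n) K)] (f : MvPowerSeries (Fin n) K) (k : ℕ) : Prop :=
  ∃ U : Set (JetSpace n K k), IsOpen U ∧ jet k f ∈ U ∧
    ∀ g : MvPowerSeries (Fin n) K, jet k g ∈ U → IsDetermined G k g

/-- The ideal `j(f)` generated by all partial derivatives of `f`. -/
def jacobianIdeal {n : ℕ} {K : Type*} [Field K] (f : MvPowerSeries (Fin n) K) :
    Ideal (MvPowerSeries (Fin n) K) :=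
  Ideal.span (Set.range fun i => MvPowerSeries.pderiv K i f)

/-- The Milnor number `μ(f) = dim K[[x]] / j(f)`. -/
def milnorNumber {n : ℕ} {K : Type*} [Field K] (f : MvPowerSeries (Fin n) K) : ℕ∞ :=
  Cardinal.toENat (Module.rank K (MvPowerSeries (Fin n) K ⧸ jacobianIdeal f))

/-- The Tjurina number `τ(f) = dim K[[x]] / (⟨f⟩ + j(f))`. -/
def tjurinaNumber {n : ℕ} {K : Type*} [Field K] (f : MvPowerSeries (Fin n) K) : ℕ∞ :=
  Cardinal.toENat (Module.rank K
    (MvPowerSeries (Fin n) K ⧸ (Ideal.span {f} ⊔ jacobianIdeal f)))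

/-- `d` is the right modality of `f`: the modality of `j^k f` under the right group for some
sufficiently large `k`. -/
def IsRightModality {n : ℕ} {K : Type*} [Field K] (f : MvPowerSeries (Fin n) K)
    (d : EReal) : Prop :=
  ∃ k, IsSufficientlyLarge (RightGroup n K) f k ∧ IsJetModality (RightGroup n K) (jet k f) d

/-- `d` is the contact modality of `f`: the modality of `j^k f` under the contact group for some
sufficiently large `k`. -/
def IsContactModality {n : ℕ} {K : Type*} [Field K] (f : MvPowerSeries (Fin n) K)
    (d : EReal) : Prop :=
  ∃ k, IsSufficientlyLarge (ContactGroup n K) f k ∧ IsJetModality (ContactGroup n K) (jet k f) d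

end

noncomputable section

open MvPolynomial Cardinal

universe u

/-! The proof is a parameter count on leading forms. Modulo higher order, an automorphism acts on a
series of order at least `m` by a linear substitution in its form of degree `m`. For `m > 0`, a unit
with constant term `c ^ m` only rescales that substitution by `c`, and `c` exists because `K` is
algebraically closed. So the leading form of any transform is a polynomial expression in the
original leading form and `n ^ 2` parameters (`unit_mul_right_form`, `ActsOnLeadingForms`), while
the forms of degree `m` fill an affine space of dimension `N = (n + m - 1).choose m`. For `m = 0` a
single parameter already gives every constant. Only dimensions are compared and no tangent spaces
occur, so the characteristic plays no role.

For the number of parameters (`le_gPar`), let `E` be the number of monomials of degree between `m +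
1` and `k`. The jets of order at least `m` form an irreducible space of dimension `N + E`, on which
orbits have dimension at most `n ^ 2 + E`. Finitely many sets of constant orbit dimension cover its
part in `U`, so one of them is dense in it, and the difference is at least `N - n ^ 2`.

For a Rosenlicht stratification (`le_gMod`), the leading form of `f` is varied with its higher terms
fixed. One stratum contains a generic member of this family, and the quotient map is given there by
rational functions whose fibres lie in orbits, hence are swept out by `n ^ 2` parameters. The fibre
dimension inequality `card_le_add_of_fiber_subset`, proved with generic points and the
Nullstellensatz, bounds the dimension of the image below by `N - n ^ 2`. -/

/-! ### Transcendence degree and the fibre dimension inequality. -/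

theorem trdeg_of_isFractionRing_mvPolynomial (K : Type u) [Field K] (ι : Type)
    (L : Type u) [Field L]
    [Algebra K L] [Algebra (MvPolynomial ι K) L] [IsScalarTower K (MvPolynomial ι K) L]
    [IsFractionRing (MvPolynomial ι K) L] :
    Algebra.trdeg K L = lift.{u} #ι := by
  have h : Algebra.IsAlgebraic (MvPolynomial ι K) L :=
    IsLocalization.isAlgebraic _ (nonZeroDivisors (MvPolynomial ι K))
  rw [← trdeg_add_eq K (MvPolynomial ι K), trdeg_eq_zero_iff.2 h, add_zero,
    MvPolynomial.trdeg_of_isDomain]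

/-- Every element of `L` is a fraction of polynomials in the coordinates. This allows a
transcendence basis of `L` over `C` to be chosen among the coordinates. -/
theorem isAlgebraic_adjoin_X {K : Type u} [Field K] {ι : Type} {L : Type u} [Field L]
    [Algebra K L] [Algebra (MvPolynomial ι K) L] [IsScalarTower K (MvPolynomial ι K) L]
    [IsFractionRing (MvPolynomial ι K) L] (C : Subalgebra K L) :
    Algebra.IsAlgebraic (Algebra.adjoin C (Set.range fun i : ι =>
      algebraMap (MvPolynomial ι K) L (X i))) L := by
  set A := Algebra.adjoin C (Set.range fun i : ι => algebraMap (MvPolynomial ι K) L (X i))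
  have key : ∀ p : MvPolynomial ι K, algebraMap (MvPolynomial ι K) L p ∈ A := by
    intro p
    induction p using MvPolynomial.induction_on with
    | C a =>
      have : algebraMap (MvPolynomial ι K) L (MvPolynomial.C a) =
          algebraMap C _ (algebraMap K C a) := by
        rw [← MvPolynomial.algebraMap_eq, ← IsScalarTower.algebraMap_apply,
          ← IsScalarTower.algebraMap_apply]
      rw [this]
      exact A.algebraMap_mem _
    | add p q hp hq => rw [map_add]; exact A.add_mem hp hq
    | mul_X p i hp => rw [map_mul]; exact A.mul_mem hp (Algebra.subset_adjoin ⟨i, rfl⟩)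
  refine ⟨fun x => ?_⟩
  obtain ⟨a, b, hb, rfl⟩ := IsFractionRing.div_surjective (A := MvPolynomial ι K) x
  rw [div_eq_mul_inv]
  exact (isAlgebraic_algebraMap (⟨_, key a⟩ : A)).mul (isAlgebraic_algebraMap (⟨_, key b⟩ : A)).inv

theorem exists_isAlgClosed_algebraicIndependent (L : Type u) [Field L] (J : Type u) :
    ∃ (Ω : Type u) (_ : Field Ω) (_ : Algebra L Ω) (_ : IsAlgClosed Ω) (y : J → Ω),
      AlgebraicIndependent L y := by
  refine ⟨AlgebraicClosure (FractionRing (MvPolynomial J L)), inferInstance, inferInstance,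
    inferInstance, fun j => algebraMap (MvPolynomial J L) _ (X j), ?_⟩
  have h := (MvPolynomial.algebraicIndependent_X J L).map'
    (f := IsScalarTower.toAlgHom L (MvPolynomial J L)
      (AlgebraicClosure (FractionRing (MvPolynomial J L)))) ?_
  · exact h
  · rw [IsScalarTower.coe_toAlgHom', IsScalarTower.algebraMap_eq (MvPolynomial J L) (FractionRing
      (MvPolynomial J L))]
    exact (algebraMap (FractionRing (MvPolynomial J L)) _).injective.comp
      (IsFractionRing.injective _ _)

/-- Algebraic independence of images under `θ` implies that of images under `χ`, if
`ker χ ≤ ker θ`. -/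
theorem AlgebraicIndependent.of_ker_le {K A B D : Type*}
    {σ : Type*} [Field K] [CommRing A] [CommRing B]
    [CommRing D] [Algebra K A] [Algebra K B] [Algebra K D] (θ : A →ₐ[K] B) (χ : A →ₐ[K] D)
    (h : RingHom.ker χ ≤ RingHom.ker θ) (v : σ → A) (hv : AlgebraicIndependent K (θ ∘ v)) :
    AlgebraicIndependent K (χ ∘ v) := by
  rw [algebraicIndependent_iff] at hv ⊢
  intro p hp
  refine hv p ?_
  have h1 : aeval (χ ∘ v) p = χ (aeval v p) := (MvPolynomial.comp_aeval_apply v χ p).symm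
  have h2 : aeval (θ ∘ v) p = θ (aeval v p) := (MvPolynomial.comp_aeval_apply v θ p).symm
  rw [h2]
  exact h (by rw [RingHom.mem_ker]; rw [← h1]; exact hp)

/-- An embedding of `L` into an algebraically closed field with prescribed values on a transcendence
basis. -/
theorem exists_algHom_of_isTranscendenceBasis
    {C L Ω J : Type u} [CommRing C] [IsDomain C] [Field L] [Field Ω]
    [IsAlgClosed Ω] [Algebra C L] [Algebra C Ω] (x : J → L)
    (hx : IsTranscendenceBasis C x) (y : J → Ω) (hy : AlgebraicIndependent C y) :
    ∃ τ : L →ₐ[C] Ω, ∀ j, τ (x j) = y j := by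
  -- Both fields become algebras over the polynomial ring on `J`. Since `L` is algebraic over it and
  -- `Ω` is algebraically closed, the map into `Ω` extends to `L`.
  let a1 : Algebra (MvPolynomial J C) L := (aeval x).toRingHom.toAlgebra
  let a2 : Algebra (MvPolynomial J C) Ω := (aeval y).toRingHom.toAlgebra
  have i1 : Function.Injective (algebraMap (MvPolynomial J C) L) := hx.1
  have i2 : Function.Injective (algebraMap (MvPolynomial J C) Ω) := hy
  have : FaithfulSMul (MvPolynomial J C) L := (faithfulSMul_iff_algebraMap_injective _ _).2 i1
  have : FaithfulSMul (MvPolynomial J C) Ω := (faithfulSMul_iff_algebraMap_injective _ _).2 i2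
  have alg : Algebra.IsAlgebraic (MvPolynomial J C) L := by
    have := hx.isAlgebraic
    refine Algebra.IsAlgebraic.of_ringHom_of_comp_eq (S := Algebra.adjoin C (Set.range x)) (B := L)
      (hx.1.aevalEquiv : _ →+* Algebra.adjoin C (Set.range x)) (RingHom.id L)
      hx.1.aevalEquiv.surjective Function.injective_id ?_
    ext p
    · rfl
    · exact hx.1.algebraMap_aevalEquiv _
  let τ : L →ₐ[MvPolynomial J C] Ω := IsAlgClosed.lift
  have hC : ∀ c : C, algebraMap (MvPolynomial J C) L (MvPolynomial.C c) = algebraMap C L c :=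
    fun c => aeval_C x c
  have hC' : ∀ c : C, algebraMap (MvPolynomial J C) Ω (MvPolynomial.C c) = algebraMap C Ω c :=
    fun c => aeval_C y c
  refine ⟨{ τ.toRingHom with commutes' := fun c => ?_ }, fun j => ?_⟩
  · change τ (algebraMap C L c) = _
    rw [← hC, τ.commutes, hC']
  · change τ (x j) = _
    have : algebraMap (MvPolynomial J C) L (X j) = x j := aeval_X x j
    rw [← this, τ.commutes]
    exact aeval_X y j

/-- The pairs `(a, b)` with the same values of all `P j / H` form a fibre product. If the generic
fibre has dimension `r = Nat.card ι - s`, there is a generic pair with `Nat.card ι + r` independent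
coordinates. By hypothesis such pairs lie in the image of `(a, g) ↦ (a, F (a, g))`, whose source has
dimension `Nat.card ι + Nat.card κ`; hence `r ≤ Nat.card κ`. -/
theorem card_le_add_of_fiber_subset {K : Type u} [Field K] [IsAlgClosed K] {ι κ τ : Type} [Finite ι]
    [Finite κ] (H : MvPolynomial ι K) (hH : H ≠ 0) (P : τ → MvPolynomial ι K)
    (F : ι → MvPolynomial (ι ⊕ κ) K)
    (hF : ∀ a b : ι → K, eval a H ≠ 0 → eval b H ≠ 0 →
      (∀ j, eval a (P j) * eval b H = eval b (P j) * eval a H) →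
      ∃ g : κ → K, ∀ i, eval (Sum.elim a g) (F i) = b i)
    {L : Type u} [Field L] [Algebra K L] [Algebra (MvPolynomial ι K) L]
    [IsScalarTower K (MvPolynomial ι K) L] [IsFractionRing (MvPolynomial ι K) L]
    (C : Subalgebra K L)
    (hC : ∀ j, algebraMap (MvPolynomial ι K) L (P j) / algebraMap (MvPolynomial ι K) L H ∈ C) (s :
        ℕ)
    (hs : Algebra.trdeg K C = s) : Nat.card ι ≤ s + Nat.card κ := by
  let q : MvPolynomial ι K →ₐ[K] L := IsScalarTower.toAlgHom K (MvPolynomial ι K) L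
  have q_inj : Function.Injective q := IsFractionRing.injective _ _
  have : Algebra.IsAlgebraic (Algebra.adjoin C (Set.range fun i : ι => q (X i))) L :=
    isAlgebraic_adjoin_X C
  obtain ⟨J, hJ, hJb⟩ := exists_isTranscendenceBasis_subset (R := C) (A := L) (Set.range fun i :
      ι => q (X i))
  obtain ⟨Ω, _, _, _, y, hy⟩ := exists_isAlgClosed_algebraicIndependent L J
  let _ : Algebra K Ω := ((algebraMap L Ω).comp (algebraMap K L)).toAlgebra
  have : IsScalarTower K L Ω := .of_algebraMap_eq fun _ => rfl
  have hyC : AlgebraicIndependent C y := hy.restrictScalars Subtype.val_injective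
  -- A second embedding of `L`, equal to the first on `C` but sending the basis over `C` to elements
  -- independent over `L`: a generic second point in the fibre of the first.
  obtain ⟨τ', hτ⟩ := exists_algHom_of_isTranscendenceBasis _ hJb y hyC
  let τ := τ'.restrictScalars K
  let l : L →ₐ[K] Ω := IsScalarTower.toAlgHom K L Ω
  have hτC : ∀ c ∈ C, τ c = l c := fun c hc => τ'.commutes ⟨c, hc⟩
  -- `θ` evaluates at the generic pair, and `χ` is the pullback along `(a, g) ↦ (a, F (a, g))`.
  let θ : MvPolynomial (ι ⊕ ι) K →ₐ[K] Ω := aeval (Sum.elim (fun i => l (q (X i))) fun i =>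
      τ (q (X i)))
  let χ : MvPolynomial (ι ⊕ ι) K →ₐ[K] MvPolynomial (ι ⊕ κ) K :=
      aeval (Sum.elim (fun i => X (Sum.inl i)) F)
  have θl : ∀ p, θ (rename Sum.inl p) = l (q p) := by
    intro p
    have : θ.comp (rename Sum.inl) = l.comp q := by ext i; simp [θ]
    exact DFunLike.congr_fun this p
  have θr : ∀ p, θ (rename Sum.inr p) = τ (q p) := by
    intro p
    have : θ.comp (rename Sum.inr) = τ.comp q := by ext i; simp [θ]
    exact DFunLike.congr_fun this p
  have ne : ∀ f : L →ₐ[K] Ω, f (q H) ≠ 0 := fun f h =>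
    hH (q_inj (f.toRingHom.injective (by rw [map_zero, map_zero]; exact h)))
  have hker : RingHom.ker χ ≤ RingHom.ker θ := by
    intro Q hQ
    let I : Ideal (MvPolynomial (ι ⊕ ι) K) := Ideal.span (Set.range fun j =>
      rename Sum.inl (P j) * rename Sum.inr H - rename Sum.inr (P j) * rename Sum.inl H)
    have hI : I ≤ RingHom.ker θ := by
      rw [Ideal.span_le]
      rintro _ ⟨j, rfl⟩
      rw [SetLike.mem_coe, RingHom.mem_ker, map_sub, map_mul, map_mul, θl, θr, θl, θr, sub_eq_zero]
      have := hτC _ (hC j)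
      rw [map_div₀, map_div₀] at this
      exact ((div_eq_div_iff (ne τ) (ne l)).1 this).symm
    -- The factors `H` kill the points about which `hF` says nothing. Elsewhere `Q` vanishes because
    -- `χ Q = 0`. The Nullstellensatz then puts a power of the product into `I`, and `θ` does not
    -- kill the factors `H`.
    have hmem : Q * (rename Sum.inl H * rename Sum.inr H) ∈ vanishingIdeal K (zeroLocus K I) := by
      intro x hx
      obtain ⟨a, b, rfl⟩ : ∃ a b : ι → K, x = Sum.elim a b :=
        ⟨x ∘ Sum.inl, x ∘ Sum.inr, (Sum.elim_comp_inl_inr x).symm⟩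
      have e1 : ∀ p, aeval (Sum.elim a b) (rename Sum.inl p) = eval a p := fun p => by
        rw [aeval_rename, Sum.elim_comp_inl]; rfl
      have e2 : ∀ p, aeval (Sum.elim a b) (rename Sum.inr p) = eval b p := fun p => by
        rw [aeval_rename, Sum.elim_comp_inr]; rfl
      rw [map_mul, map_mul, e1, e2]
      by_cases ha : eval a H = 0
      · rw [ha, zero_mul, mul_zero]
      by_cases hb : eval b H = 0
      · rw [hb, mul_zero, mul_zero]
      obtain ⟨g, hg⟩ := hF a b ha hb fun j => by
        have := hx _ (Ideal.subset_span ⟨j, rfl⟩)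
        rw [map_sub, map_mul, map_mul, e1, e2, e1, e2, sub_eq_zero] at this
        exact this
      have : aeval (Sum.elim a b) Q = aeval (Sum.elim a g) (χ Q) := by
        have : (aeval (Sum.elim a b) : MvPolynomial (ι ⊕ ι) K →ₐ[K] K) =
            (aeval (Sum.elim a g) : _ →ₐ[K] K).comp χ := by
          ext (i | i)
          · simp [χ]
          · simp only [χ, AlgHom.comp_apply, aeval_X, Sum.elim_inr]
            exact (hg i).symm
        exact DFunLike.congr_fun this Q
      rw [this, (RingHom.mem_ker).1 hQ, map_zero, zero_mul]
    rw [vanishingIdeal_zeroLocus_eq_radical] at hmem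
    obtain ⟨k, hk⟩ := hmem
    have := hI hk
    rw [RingHom.mem_ker, map_pow, map_mul, map_mul, θl, θr] at this
    exact (mul_eq_zero.1 (eq_zero_of_pow_eq_zero this)).resolve_right (mul_ne_zero (ne l) (ne τ))
  choose idx hidx using hJ
  -- All coordinates of the first point, and those of the second that belong to the basis `J`.
  let v : J ⊕ ι → MvPolynomial (ι ⊕ ι) K :=
    Sum.elim (fun j => X (Sum.inr (idx j.2))) fun i => X (Sum.inl i)
  have hind : AlgebraicIndependent K (Sum.elim y (algebraMap L Ω ∘ fun i => q (X i))) :=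
    ((MvPolynomial.algebraicIndependent_X ι K).map' q_inj).sumElim_comp hy
  have hv : AlgebraicIndependent K (χ ∘ v) := by
    refine AlgebraicIndependent.of_ker_le θ χ hker v ?_
    convert hind using 1
    ext (j | i)
    · simp only [v, θ, Function.comp, Sum.elim_inl, aeval_X, Sum.elim_inr]
      have := hidx j.2
      dsimp only at this
      rw [this]
      exact hτ j
    · simp only [v, θ, Function.comp, Sum.elim_inl, aeval_X, Sum.elim_inr]
      rfl
  -- The count is `#J + #ι ≤ #ι + #κ`, combined with `s + #J = #ι`.
  have h1 := hv.lift_cardinalMk_le_trdeg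
  rw [MvPolynomial.trdeg_of_isDomain] at h1
  have h2 : Algebra.trdeg K C + Algebra.trdeg C L = Algebra.trdeg K L := trdeg_add_eq K C
  rw [trdeg_of_isFractionRing_mvPolynomial K ι L, hs, ← hJb.cardinalMk_eq_trdeg] at h2
  have hJfin : Finite J := (Set.finite_range fun i :
      ι => q (X i)).subset fun x hx => ⟨idx hx, hidx hx⟩
  rw [lift_id, ← Nat.cast_card, ← Nat.cast_card, lift_natCast, lift_natCast, Nat.cast_le,
    Nat.card_sum, Nat.card_sum] at h1
  rw [← Nat.cast_card, ← Nat.cast_card, lift_natCast, ← Nat.cast_add, Nat.cast_inj] at h2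
  change s + Nat.card J = _ at h2
  omega

/-! ### Polynomial functions and the Zariski topology. -/

section Zariski

variable {K V W : Type*} [Field K] [AddCommGroup V] [Module K V] [AddCommGroup W] [Module K W]

theorem polyFun_comp_mem {φ : V → W} (hφ : ∀ l : Module.Dual K W, (fun v => l (φ v)) ∈ polyFun K V)
    {p : W → K} (hp : p ∈ polyFun K W) : (fun v => p (φ v)) ∈ polyFun K V := by
  induction hp using Algebra.adjoin_induction with
  | mem x hx => obtain ⟨l, rfl⟩ := hx; exact hφ l
  | algebraMap r => exact (polyFun K V).algebraMap_mem r
  | add x y _ _ hx hy => exact (polyFun K V).add_mem hx hy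
  | mul x y _ _ hx hy => exact (polyFun K V).mul_mem hx hy

theorem dual_mem_polyFun (l : Module.Dual K V) : (fun v => l v) ∈ polyFun K V :=
  Algebra.subset_adjoin ⟨l, rfl⟩

theorem zariski_isTopologicalBasis :
    @TopologicalSpace.IsTopologicalBasis V (zariski K V)
      {U | ∃ p ∈ polyFun K V, U = {v | p v ≠ 0}} := by
  let _ := zariski K V
  refine ⟨?_, ?_, rfl⟩
  · rintro _ ⟨p, hp, rfl⟩ _ ⟨q, hq, rfl⟩ x hx
    exact ⟨_, ⟨p * q, mul_mem hp hq, rfl⟩, mul_ne_zero hx.1 hx.2,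
      fun y hy => ⟨left_ne_zero_of_mul hy, right_ne_zero_of_mul hy⟩⟩
  · exact Set.eq_univ_of_forall fun x => ⟨_, ⟨1, one_mem _, rfl⟩, one_ne_zero (α := K)⟩

theorem continuous_zariski {φ : V → W}
    (hφ : ∀ l : Module.Dual K W, (fun v => l (φ v)) ∈ polyFun K V) :
    @Continuous V W (zariski K V) (zariski K W) φ := by
  let _ := zariski K V
  let _ := zariski K W
  refine zariski_isTopologicalBasis.continuous_iff.2 ?_
  rintro _ ⟨p, hp, rfl⟩
  exact zariski_isTopologicalBasis.isOpen ⟨_, polyFun_comp_mem hφ hp, rfl⟩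

theorem continuous_zariski_linearMap (φ : V →ₗ[K] W) :
    @Continuous V W (zariski K V) (zariski K W) φ :=
  continuous_zariski fun l => dual_mem_polyFun (l ∘ₗ φ)

theorem isHomeomorph_zariski_linearEquiv (φ : V ≃ₗ[K] W) :
    @IsHomeomorph V W (zariski K V) (zariski K W) φ :=
  let _ := zariski K V
  let _ := zariski K W
  (Homeomorph.mk φ.toEquiv (continuous_zariski_linearMap φ.toLinearMap)
    (continuous_zariski_linearMap φ.symm.toLinearMap)).isHomeomorph

theorem mem_polyFun_pi {σ : Type*} [Finite σ] {p : (σ → K) → K} :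
    p ∈ polyFun K (σ → K) ↔ ∃ P : MvPolynomial σ K, p = fun v => eval v P := by
  constructor
  · intro hp
    induction hp using Algebra.adjoin_induction with
    | mem x hx =>
      obtain ⟨l, rfl⟩ := hx
      have := Fintype.ofFinite σ
      classical
      refine ⟨∑ i, MvPolynomial.C (l (Pi.single i 1)) * X i, ?_⟩
      ext v
      simp only [map_sum, map_mul, eval_C, eval_X]
      conv_lhs => rw [← LinearMap.sum_single_apply (fun _ => K) v]
      rw [map_sum]
      refine Finset.sum_congr rfl fun i _ => ?_
      rw [mul_comm, ← smul_eq_mul, ← map_smul, ← Pi.single_smul, smul_eq_mul, mul_one]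
    | algebraMap r => exact ⟨MvPolynomial.C r, by ext; simp⟩
    | add x y _ _ hx hy =>
      obtain ⟨P, rfl⟩ := hx
      obtain ⟨Q, rfl⟩ := hy
      exact ⟨P + Q, by ext; simp⟩
    | mul x y _ _ hx hy =>
      obtain ⟨P, rfl⟩ := hx
      obtain ⟨Q, rfl⟩ := hy
      exact ⟨P * Q, by ext; simp⟩
  · rintro ⟨P, rfl⟩
    induction P using MvPolynomial.induction_on with
    | C a =>
      have h : (fun v : σ → K => eval v (MvPolynomial.C a)) = algebraMap K ((σ → K) → K) a := by
        ext; simp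
      exact h ▸ (polyFun K (σ → K)).algebraMap_mem a
    | add p q hp hq => simpa using! add_mem hp hq
    | mul_X p i hp =>
      simpa using! mul_mem hp (dual_mem_polyFun (LinearMap.proj i : (σ → K) →ₗ[K] K))

end Zariski

/-- The Zariski topology on the affine space `K ^ σ`. -/
@[reducible] def piZariski {σ K : Type*} [Field K] : TopologicalSpace (σ → K) := zariski K (σ → K)

attribute [local instance] piZariski

/-! ### Closed sets of affine space and ideals. -/

section Pi

variable {K σ : Type*} [Field K] [Finite σ]

theorem isOpen_piZariski_iff {U : Set (σ → K)} :
    IsOpen U ↔ ∀ x ∈ U, ∃ P : MvPolynomial σ K, eval x P ≠ 0 ∧ ∀ y, eval y P ≠ 0 → y ∈ U := by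
  rw [zariski_isTopologicalBasis.isOpen_iff]
  refine forall₂_congr fun x _ => ⟨?_, ?_⟩
  · rintro ⟨_, ⟨p, hp, rfl⟩, hx, hU⟩
    obtain ⟨P, rfl⟩ := mem_polyFun_pi.1 hp
    exact ⟨P, hx, hU⟩
  · rintro ⟨P, hx, hU⟩
    exact ⟨_, ⟨_, mem_polyFun_pi.2 ⟨P, rfl⟩, rfl⟩, hx, hU⟩

theorem closure_piZariski (S : Set (σ → K)) : closure S = zeroLocus K (vanishingIdeal K S) := by
  ext x
  rw [mem_closure_iff]
  constructor
  · intro h p hp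
    by_contra hx
    obtain ⟨y, hy, hyS⟩ := h {y | eval y p ≠ 0}
      (isOpen_piZariski_iff.2 fun z hz => ⟨p, hz, fun _ h => h⟩) hx
    exact hy (hp y hyS)
  · intro h U hU hx
    obtain ⟨P, hP, hPU⟩ := isOpen_piZariski_iff.1 hU x hx
    by_contra hne
    refine hP (h P fun y hy => ?_)
    by_contra hy'
    exact hne ⟨y, hPU y hy', hy⟩

theorem isClosed_zeroLocus (I : Ideal (MvPolynomial σ K)) : IsClosed (zeroLocus K I) :=
  closure_eq_iff_isClosed.1 (by
    rw [closure_piZariski]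
    exact zeroLocus_vanishingIdeal_galoisConnection.l_u_l_eq_l I)

theorem isPrime_vanishingIdeal {S : Set (σ → K)} (hS : IsIrreducible S) :
    (vanishingIdeal K S).IsPrime := by
  refine ⟨fun h => ?_, fun {p q} hpq => ?_⟩
  · obtain ⟨x, hx⟩ := hS.1
    have : (1 : MvPolynomial σ K) ∈ vanishingIdeal K S := h ▸ Submodule.mem_top
    exact one_ne_zero ((map_one _).symm.trans (this x hx))
  · by_contra! hne
    rw [mem_vanishingIdeal_iff, mem_vanishingIdeal_iff] at hne
    push Not at hne
    obtain ⟨⟨x, hx, hxp⟩, y, hy, hyq⟩ := hne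
    have op : ∀ p : MvPolynomial σ K, IsOpen {y | eval y p ≠ 0} := fun p =>
      isOpen_piZariski_iff.2 fun z hz => ⟨p, hz, fun _ h => h⟩
    obtain ⟨z, hz, h1, h2⟩ := hS.2 _ _ (op p) (op q) ⟨x, hx, hxp⟩ ⟨y, hy, hyq⟩
    have := hpq z hz
    rw [map_mul] at this
    exact mul_ne_zero h1 h2 this

theorem isIrreducible_zeroLocus [IsAlgClosed K] (P : Ideal (MvPolynomial σ K)) [hP : P.IsPrime] :
    IsIrreducible (zeroLocus K P) := by
  have key : ∀ p : MvPolynomial σ K, (∀ x ∈ zeroLocus K P, eval x p = 0) → p ∈ P := fun p hp => by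
    rw [← MvPolynomial.IsPrime.vanishingIdeal_zeroLocus (K := K) P]
    exact hp
  refine ⟨?_, fun U V hU hV ⟨x, hx, hxU⟩ ⟨y, hy, hyV⟩ => ?_⟩
  · by_contra h
    rw [Set.not_nonempty_iff_eq_empty] at h
    exact hP.ne_top ((Ideal.eq_top_iff_one _).2 (key 1 (by simp [h])))
  · obtain ⟨p, hp, hpU⟩ := isOpen_piZariski_iff.1 hU x hxU
    obtain ⟨q, hq, hqV⟩ := isOpen_piZariski_iff.1 hV y hyV
    by_contra hne
    have : p * q ∈ P := key _ fun z hz => by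
      by_contra h
      rw [map_mul] at h
      exact hne ⟨z, hz, hpU z (left_ne_zero_of_mul h), hqV z (right_ne_zero_of_mul h)⟩
    exact (hP.mem_or_mem this).elim (fun h => hp (hx p h)) fun h => hq (hy q h)

/-- A closed set is determined by its vanishing ideal, so a strict chain of irreducible closed sets
gives a strict chain of primes containing `J`. -/
theorem topologicalKrullDim_closure_le {S : Set (σ → K)} {J : Ideal (MvPolynomial σ K)}
    (hJ : J ≤ vanishingIdeal K S) :
    topologicalKrullDim (closure S) ≤ ringKrullDim (MvPolynomial σ K ⧸ J) := by
  rw [ringKrullDim_quotient, ← Order.krullDim_orderDual, topologicalKrullDim]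
  have cont : Continuous (Subtype.val : closure S → σ → K) := continuous_subtype_val
  let g : TopologicalSpace.IrreducibleCloseds (closure S) →
      TopologicalSpace.IrreducibleCloseds (σ → K) := TopologicalSpace.IrreducibleCloseds.map _ cont
  have hg : StrictMono g :=
    TopologicalSpace.IrreducibleCloseds.map_strictMono_of_isInducing Topology.IsInducing.subtypeVal
  have hgS : ∀ Z, (g Z : Set (σ → K)) ⊆ closure S := fun Z =>
    closure_minimal (by rintro _ ⟨x, _, rfl⟩; exact x.2) isClosed_closure
  let f : TopologicalSpace.IrreducibleCloseds (closure S) →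
      (PrimeSpectrum.zeroLocus (R := MvPolynomial σ K) J)ᵒᵈ := fun Z =>
    OrderDual.toDual ⟨⟨vanishingIdeal K (g Z : Set (σ →
        K)), isPrime_vanishingIdeal (g Z).isIrreducible⟩, by
      exact hJ.trans fun p hp x hx => ((closure_piZariski S).subset (hgS Z hx)) p hp⟩
  refine Order.krullDim_le_of_strictMono f fun A B hAB => ?_
  have h := hg hAB
  have h1 : (g A : Set (σ → K)) ⊆ g B := h.le
  refine lt_of_le_of_ne (vanishingIdeal_anti_mono h1) fun heq => h.ne ?_
  have heq : vanishingIdeal K (g B : Set (σ → K)) = vanishingIdeal K (g A : Set (σ → K)) :=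
    congrArg (fun x => x.1.asIdeal) heq.symm
  apply SetLike.coe_injective
  rw [← (g A).isClosed.closure_eq, ← (g B).isClosed.closure_eq, closure_piZariski,
      closure_piZariski,
    heq]

/-- By the Nullstellensatz a prime is determined by its zero locus, so chains of primes over `J`
give chains of irreducible closed subsets of the closure. -/
theorem le_topologicalKrullDim_closure [IsAlgClosed K] {S : Set (σ → K)}
    {J : Ideal (MvPolynomial σ K)} (hJ : vanishingIdeal K S ≤ J) :
    ringKrullDim (MvPolynomial σ K ⧸ J) ≤ topologicalKrullDim (closure S) := by
  rw [ringKrullDim_quotient, ← Order.krullDim_orderDual, topologicalKrullDim]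
  have sub : ∀ P : (PrimeSpectrum.zeroLocus (R := MvPolynomial σ K) J)ᵒᵈ,
      zeroLocus K (OrderDual.ofDual P).1.asIdeal ⊆ closure S := fun P => by
    rw [closure_piZariski]
    exact zeroLocus_anti_mono (hJ.trans (OrderDual.ofDual P).2)
  let f : (PrimeSpectrum.zeroLocus (R := MvPolynomial σ K) J)ᵒᵈ →
      TopologicalSpace.IrreducibleCloseds (closure S) := fun P =>
    { carrier := Subtype.val ⁻¹' zeroLocus K (OrderDual.ofDual P).1.asIdeal
      isIrreducible' := by
        have hP := isIrreducible_zeroLocus (OrderDual.ofDual P).1.asIdeal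
        refine ⟨?_, ?_⟩
        · obtain ⟨x, hx⟩ := hP.1
          exact ⟨⟨x, sub P hx⟩, hx⟩
        · rintro _ _ ⟨U, hU, rfl⟩ ⟨V, hV, rfl⟩ ⟨x, hx, hxU⟩ ⟨y, hy, hyV⟩
          obtain ⟨z, hz, h⟩ := hP.2 U V hU hV ⟨x, hx, hxU⟩ ⟨y, hy, hyV⟩
          exact ⟨⟨z, sub P hz⟩, hz, h⟩
      isClosed' := (isClosed_zeroLocus _).preimage continuous_subtype_val }
  refine Order.krullDim_le_of_strictMono f (Monotone.strictMono_of_injective ?_ ?_)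
  · intro P Q hPQ x hx
    exact zeroLocus_anti_mono (show (OrderDual.ofDual Q).1.asIdeal ≤
        (OrderDual.ofDual P).1.asIdeal from hPQ) hx
  · intro P Q hPQ
    have h : zeroLocus K (OrderDual.ofDual P).1.asIdeal = zeroLocus K
        (OrderDual.ofDual Q).1.asIdeal := by
      have h := congrArg (fun Z : TopologicalSpace.IrreducibleCloseds (closure S) =>
        Subtype.val '' (Z : Set (closure S))) hPQ
      have hf : ∀ P, (f P : Set (closure S)) =
        Subtype.val ⁻¹' zeroLocus K (OrderDual.ofDual P).1.asIdeal := fun _ => rfl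
      beta_reduce at h
      rwa [hf, hf, Subtype.image_preimage_coe, Subtype.image_preimage_coe,
        Set.inter_eq_right.2 (sub P), Set.inter_eq_right.2 (sub Q)] at h
    apply OrderDual.ofDual.injective
    apply Subtype.ext
    apply PrimeSpectrum.ext
    rw [← MvPolynomial.IsPrime.vanishingIdeal_zeroLocus (K := K) (OrderDual.ofDual P).1.asIdeal, h,
      MvPolynomial.IsPrime.vanishingIdeal_zeroLocus]

end Pi

/-! ### Krull dimension, transcendence degree and images of polynomial maps. -/

/-- Lying over and going up lift chains of primes to `S`; incomparability keeps chains strict under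
contraction to `R`. -/
theorem ringKrullDim_eq_of_isIntegral {R S : Type*} [CommRing R] [CommRing S] [Algebra R S]
    [Algebra.IsIntegral R S] [FaithfulSMul R S] : ringKrullDim R = ringKrullDim S := by
  apply le_antisymm
  · refine iSup_le fun l => ?_
    obtain ⟨P, _, hP⟩ := Ideal.nonempty_primesOver (S := S) l.head.asIdeal
    obtain ⟨l', hl', -⟩ := Ideal.exists_ltSeries_of_hasGoingUp (S := S) l P
    rw [← hl']
    exact Order.LTSeries.length_le_krullDim l'
  · exact Order.krullDim_le_of_strictMono (PrimeSpectrum.comap (algebraMap R S)) fun P Q hPQ =>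
      Ideal.IsIntegral.comap_lt_comap hPQ

/-- Noether normalization: both invariants are unchanged by the integral extension, and both equal
`s` for a polynomial ring in `s` variables. -/
theorem exists_trdeg_eq_ringKrullDim (K : Type u) [Field K]
    (C : Type u) [CommRing C] [IsDomain C] [Algebra K C]
    [Algebra.FiniteType K C] : ∃ s : ℕ, Algebra.trdeg K C = s ∧ ringKrullDim C = s := by
  obtain ⟨s, g, hg, hint⟩ := exists_integral_inj_algHom_of_fg K C
  refine ⟨s, ?_, ?_⟩
  all_goals
    let _ : Algebra (MvPolynomial (Fin s) K) C := g.toRingHom.toAlgebra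
    have : IsScalarTower K (MvPolynomial (Fin s) K) C :=
        .of_algebraMap_eq fun x => (g.commutes x).symm
    have : Algebra.IsIntegral (MvPolynomial (Fin s) K) C := ⟨hint⟩
    have : FaithfulSMul (MvPolynomial (Fin s) K) C :=
        (faithfulSMul_iff_algebraMap_injective _ _).2 hg
  · rw [← trdeg_add_eq K (MvPolynomial (Fin s) K),
      (trdeg_eq_zero_iff (R := MvPolynomial (Fin s) K)).2 inferInstance, add_zero,
      MvPolynomial.trdeg_of_isDomain]
    simp
  · rw [← ringKrullDim_eq_of_isIntegral (R := MvPolynomial (Fin s) K),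
      MvPolynomial.ringKrullDim_of_isNoetherianRing]
    simp

/-- The coordinate ring of the closure of the range is a subalgebra of the polynomial ring on `α`,
so its transcendence degree is at most `Nat.card α`. -/
theorem topologicalKrullDim_closure_le_of_subset_range {K : Type u} [Field K]
    {σ α : Type} [Finite σ]
    [Finite α] (Φ : σ → MvPolynomial α K) {S : Set (σ → K)}
    (hS : S ⊆ Set.range fun (a : α → K) i => eval a (Φ i)) :
    topologicalKrullDim (closure S) ≤ Nat.card α := by
  let φ : MvPolynomial σ K →ₐ[K] MvPolynomial α K := aeval Φ
  have hker : RingHom.ker φ ≤ vanishingIdeal K S := fun p hp x hx => by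
    obtain ⟨a, rfl⟩ := hS hx
    have : aeval (fun i => eval a (Φ i)) p = aeval a (φ p) := by
      rw [MvPolynomial.comp_aeval_apply]
      rfl
    rw [this, RingHom.mem_ker.1 hp, map_zero]
  refine (topologicalKrullDim_closure_le hker).trans ?_
  rw [ringKrullDim_eq_of_ringEquiv (Ideal.quotientKerEquivRange φ).toRingEquiv]
  have hfin : Algebra.FiniteType K φ.range := .of_surjective φ.rangeRestrict
      φ.rangeRestrict_surjective
  obtain ⟨s, hs, hs'⟩ := exists_trdeg_eq_ringKrullDim K φ.range
  rw [hs']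
  have := lift_trdeg_le_of_injective φ.range.val Subtype.val_injective
  rw [hs, MvPolynomial.trdeg_of_isDomain, ← Nat.cast_card, lift_natCast, lift_natCast,
      lift_natCast, Nat.cast_le] at this
  exact_mod_cast this

/-- Geometric form of the fibre inequality: `S` contains the image of the open set `H ≠ 0` under the
functions `P j / H`, and the algebra these generate has dimension at most that of the closure of
`S`. -/
theorem card_le_topologicalKrullDim_closure_add {K : Type u} [Field K] [IsAlgClosed K]
    {σ ι κ : Type} [Finite σ]
    [Finite ι] [Finite κ] (H : MvPolynomial ι K) (hH : H ≠ 0) (P : σ → MvPolynomial ι K)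
    (F : ι → MvPolynomial (ι ⊕ κ) K)
    (hF : ∀ a b : ι → K, eval a H ≠ 0 → eval b H ≠ 0 →
      (∀ j, eval a (P j) / eval a H = eval b (P j) / eval b H) →
      ∃ g : κ → K, ∀ i, eval (Sum.elim a g) (F i) = b i)
    (L : Type u) [Field L] [Algebra K L] [Algebra (MvPolynomial ι K) L]
    [IsScalarTower K (MvPolynomial ι K) L] [IsFractionRing (MvPolynomial ι K) L]
    {S : Set (σ → K)} (hS : ∀ a : ι → K, eval a H ≠ 0 → (fun j => eval a (P j) / eval a H) ∈ S) :
    (Nat.card ι : WithBot ℕ∞) ≤ topologicalKrullDim (closure S) + Nat.card κ := by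
  let q : MvPolynomial ι K →ₐ[K] L := IsScalarTower.toAlgHom K (MvPolynomial ι K) L
  have q_inj : Function.Injective q := IsFractionRing.injective _ _
  have hqH : q H ≠ 0 := fun h => hH (q_inj (h.trans (map_zero q).symm))
  let φ : MvPolynomial σ K →ₐ[K] L := aeval fun j => q (P j) / q H
  have hfin : Algebra.FiniteType K φ.range := .of_surjective φ.rangeRestrict
      φ.rangeRestrict_surjective
  obtain ⟨s, hs, hs'⟩ := exists_trdeg_eq_ringKrullDim K φ.range
  have key := card_le_add_of_fiber_subset H hH P F (fun a b ha hb hab => hF a b ha hb fun j =>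
    (div_eq_div_iff ha hb).2 (hab j)) φ.range (fun j => ⟨X j, aeval_X _ j⟩) s hs
  -- Clearing denominators with one numerator `r`, valid both in `L` and pointwise where `H ≠ 0`. It
  -- turns vanishing on `S` into vanishing in `L`.
  have num : ∀ p : MvPolynomial σ K, ∃ (d : ℕ) (r : MvPolynomial ι K), q r = φ p * q H ^ d ∧
      ∀ a, eval a H ≠ 0 → eval a r = eval (fun j => eval a (P j) / eval a H) p * eval a H ^ d := by
    intro p
    induction p using MvPolynomial.induction_on with
    | C a =>
      refine ⟨0, MvPolynomial.C a, ?_, fun _ _ => by simp⟩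
      rw [pow_zero, mul_one, ← MvPolynomial.algebraMap_eq, ← MvPolynomial.algebraMap_eq,
          AlgHom.commutes, AlgHom.commutes]
    | add p p' hp hp' =>
      obtain ⟨d, r, h1, h2⟩ := hp
      obtain ⟨d', r', h1', h2'⟩ := hp'
      refine ⟨d + d', r * H ^ d' + r' * H ^ d, ?_, fun a ha => ?_⟩
      · rw [map_add, map_mul, map_mul, map_pow, map_pow, h1, h1', map_add]
        ring
      · rw [map_add, map_mul, map_mul, map_pow, map_pow, h2 a ha, h2' a ha, map_add]
        ring
    | mul_X p i hp =>
      obtain ⟨d, r, h1, h2⟩ := hp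
      refine ⟨d + 1, r * P i, ?_, fun a ha => ?_⟩
      · have : φ (X i) = q (P i) / q H := aeval_X _ i
        rw [map_mul, h1, map_mul, this]
        field_simp
        ring
      · rw [map_mul, h2 a ha, map_mul, eval_X]
        field_simp
        ring
  have hker : vanishingIdeal K S ≤ RingHom.ker φ := by
    intro p hp
    obtain ⟨d, r, h1, h2⟩ := num p
    have : r * H = 0 := by
      refine MvPolynomial.funext fun a => ?_
      rw [map_zero, map_mul]
      by_cases ha : eval a H = 0
      · rw [ha, mul_zero]
      · have h3 : eval (fun j => eval a (P j) / eval a H) p = 0 := hp _ (hS a ha)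
        rw [h2 a ha, h3, zero_mul, zero_mul]
    rw [(mul_eq_zero.1 this).resolve_right hH, map_zero] at h1
    exact (mul_eq_zero.1 h1.symm).resolve_right (pow_ne_zero _ hqH)
  have h := le_topologicalKrullDim_closure hker
  rw [ringKrullDim_eq_of_ringEquiv (Ideal.quotientKerEquivRange φ).toRingEquiv, hs'] at h
  calc (Nat.card ι : WithBot ℕ∞) ≤ (s : WithBot ℕ∞) + Nat.card κ := by exact_mod_cast key
    _ ≤ _ := by gcongr

/-! ### Powers of the maximal ideal, leading forms and linear substitutions. -/

section PowerSeries

variable {n : ℕ} {K : Type*} [Field K]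

local notation "𝔪" => IsLocalRing.maximalIdeal (MvPowerSeries (Fin n) K)

theorem mem_maximalIdeal_iff_constantCoeff {f : MvPowerSeries (Fin n) K} :
    f ∈ 𝔪 ↔ MvPowerSeries.constantCoeff f = 0 := by
  rw [IsLocalRing.mem_maximalIdeal, mem_nonunits_iff, MvPowerSeries.isUnit_iff_constantCoeff,
    isUnit_iff_ne_zero, not_not]

theorem le_order_of_mem_maximalIdeal_pow (k : ℕ) :
    ∀ f ∈ 𝔪 ^ k, (k : ℕ∞) ≤ f.order := by
  induction k with
  | zero => intro f _; simp
  | succ k ih =>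
    intro f hf
    rw [pow_succ] at hf
    induction hf using Submodule.mul_induction_on' with
    | mem_mul_mem a ha b hb =>
      rw [mem_maximalIdeal_iff_constantCoeff, ← MvPowerSeries.one_le_order_iff_constCoeff_eq_zero]
          at hb
      refine le_trans ?_ MvPowerSeries.le_order_mul
      push_cast
      exact add_le_add (ih a ha) hb
    | add a _ b _ ha hb => exact le_trans (le_min ha hb) MvPowerSeries.min_order_le_add

theorem X_mem_maximalIdeal (i : Fin n) : (MvPowerSeries.X i : MvPowerSeries (Fin n) K) ∈ 𝔪 := by
  rw [mem_maximalIdeal_iff_constantCoeff, MvPowerSeries.constantCoeff_X]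

/-- Each nonconstant monomial is assigned to one variable that divides it; `g i` collects the
monomials assigned to `i`, divided by that variable. -/
theorem exists_eq_sum_X_mul {k : ℕ} {f : MvPowerSeries (Fin n) K} (hf : ((k + 1 : ℕ) :
    ℕ∞) ≤ f.order) :
    ∃ g : Fin n → MvPowerSeries (Fin n) K, (∀ i, (k : ℕ∞) ≤ (g i).order) ∧
      f = ∑ i, MvPowerSeries.X i * g i := by
  classical
  have hc : ∀ e : Fin n →₀ ℕ, e ≠ 0 → ∃ i, e i ≠ 0 := fun e he => by
    by_contra! h
    exact he (Finsupp.ext h)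
  choose c hc using hc
  let g : Fin n → MvPowerSeries (Fin n) K := fun i e =>
    if ∃ he, c (e + Finsupp.single i 1) he = i then MvPowerSeries.coeff
        (e + Finsupp.single i 1) f else 0
  have hg : ∀ i e, MvPowerSeries.coeff e (g i) =
    if ∃ he, c (e + Finsupp.single i 1) he = i then MvPowerSeries.coeff
        (e + Finsupp.single i 1) f else 0 :=
    fun _ _ => rfl
  refine ⟨g, fun i => MvPowerSeries.nat_le_order fun e he => ?_, ?_⟩
  · rw [hg]
    split_ifs
    · refine MvPowerSeries.coeff_of_lt_order (lt_of_lt_of_le ?_ hf)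
      rw [map_add, Finsupp.degree_single]
      exact_mod_cast Nat.add_lt_add_right he 1
    · rfl
  · ext e
    rw [map_sum]
    have key : ∀ i, MvPowerSeries.coeff e (MvPowerSeries.X i * g i) =
        if ∃ he, c e he = i then MvPowerSeries.coeff e f else 0 := by
      intro i
      rw [MvPowerSeries.X, MvPowerSeries.coeff_monomial_mul, one_mul]
      by_cases h : Finsupp.single i 1 ≤ e
      · rw [if_pos h, hg, tsub_add_cancel_of_le h]
      · rw [if_neg h, if_neg]
        rintro ⟨he, rfl⟩
        refine h (Finsupp.single_le_iff.2 (Nat.one_le_iff_ne_zero.2 (hc e he)))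
    simp_rw [key]
    by_cases he : e = 0
    · subst he
      simp only [ne_eq, not_true_eq_false, IsEmpty.exists_iff, if_false, Finset.sum_const_zero]
      refine MvPowerSeries.coeff_of_lt_order (lt_of_lt_of_le ?_ hf)
      rw [map_zero]
      exact_mod_cast Nat.succ_pos k
    · simp [he]

theorem mem_maximalIdeal_pow_iff {k : ℕ} {f : MvPowerSeries (Fin n) K} :
    f ∈ 𝔪 ^ k ↔ ∀ d : Fin n →₀ ℕ, d.degree < k → MvPowerSeries.coeff d f = 0 := by
  constructor
  · intro hf d hd
    exact MvPowerSeries.coeff_of_lt_order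
      (lt_of_lt_of_le (by exact_mod_cast hd) (le_order_of_mem_maximalIdeal_pow k f hf))
  · intro h
    have h : (k : ℕ∞) ≤ f.order := MvPowerSeries.nat_le_order h
    induction k generalizing f with
    | zero => simp
    | succ k ih =>
      obtain ⟨g, hg, rfl⟩ := exists_eq_sum_X_mul h
      refine Ideal.sum_mem _ fun i _ => ?_
      rw [pow_succ']
      exact Ideal.mul_mem_mul (X_mem_maximalIdeal i)
        (ih (fun d hd => MvPowerSeries.coeff_of_lt_order (lt_of_lt_of_le (by exact_mod_cast hd)
            (hg i))) (hg i))

/-- The exponents of the monomials of degree `m` in `n` variables. -/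
abbrev HomExp (n m : ℕ) : Type := {e : Fin n →₀ ℕ // e.degree = m}

instance (n m : ℕ) : Finite (HomExp n m) :=
  ((Finsupp.finite_of_degree_le (σ := Fin n) m).subset fun _ h => le_of_eq h).to_subtype

instance (n m : ℕ) : Fintype (HomExp n m) := Fintype.ofFinite _

theorem card_homExp (n m : ℕ) : Nat.card (HomExp n m) = (n + m - 1).choose m := by
  have h := Finset.card_finsuppAntidiag_nat_eq_choose (s := (Finset.univ : Finset (Fin n))) m
  rw [Finset.card_univ, Fintype.card_fin] at h
  rw [← h]
  exact Nat.subtype_card _ fun e => by simp [Finsupp.degree_eq_sum]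

/-- The homogeneous form with given coefficients, as a power series. -/
def form {m : ℕ} : (HomExp n m → K) →ₗ[K] MvPowerSeries (Fin n) K where
  toFun a := ∑ e, MvPowerSeries.monomial e.1 (a e)
  map_add' a b := by simp [Finset.sum_add_distrib]
  map_smul' c a := by
    rw [Finset.smul_sum]
    exact Finset.sum_congr rfl fun e _ => map_smul (MvPowerSeries.monomial e.1) c (a e)

theorem coeff_form {m : ℕ} (a : HomExp n m → K) (d : Fin n →₀ ℕ) :
    MvPowerSeries.coeff d (form a) = if h : d.degree = m then a ⟨d, h⟩ else 0 := by
  classical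
  change MvPowerSeries.coeff d (∑ e : HomExp n m, MvPowerSeries.monomial e.1 (a e)) = _
  rw [map_sum]
  simp_rw [MvPowerSeries.coeff_monomial]
  split_ifs with h
  · rw [Finset.sum_eq_single ⟨d, h⟩]
    · simp
    · rintro e - he
      exact if_neg fun hd => he (Subtype.ext hd.symm)
    · simp
  · refine Finset.sum_eq_zero fun e _ => if_neg ?_
    rintro rfl
    exact h e.2

theorem sub_form_mem {m : ℕ} {f : MvPowerSeries (Fin n) K} (hf : f ∈ 𝔪 ^ m) :
    f - form (fun e : HomExp n m => MvPowerSeries.coeff e.1 f) ∈ 𝔪 ^ (m + 1) := by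
  refine mem_maximalIdeal_pow_iff.2 fun d hd => ?_
  rw [map_sub, coeff_form]
  split_ifs with h
  · exact sub_self _
  · rw [sub_zero]
    exact mem_maximalIdeal_pow_iff.1 hf d (by omega)

/-- `x` lies in `𝔪 ^ p` and has the same leading part as `x'`. -/
def LeadEq (p : ℕ) (x x' : MvPowerSeries (Fin n) K) : Prop :=
  x ∈ 𝔪 ^ p ∧ x - x' ∈ 𝔪 ^ (p + 1)

theorem LeadEq.right_mem {p : ℕ} {x x' : MvPowerSeries (Fin n) K} (h : LeadEq p x x') :
    x' ∈ 𝔪 ^ p := by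
  have := Ideal.sub_mem _ h.1 (Ideal.pow_le_pow_right p.le_succ h.2)
  rwa [sub_sub_cancel] at this

theorem LeadEq.mul {p q : ℕ} {x x' y y' : MvPowerSeries (Fin n) K} (hx : LeadEq p x x')
    (hy : LeadEq q y y') : LeadEq (p + q) (x * y) (x' * y') := by
  refine ⟨pow_add 𝔪 p q ▸ Ideal.mul_mem_mul hx.1 hy.1, ?_⟩
  have h : x * y - x' * y' = x * (y - y') + (x - x') * y' := by ring
  rw [h]
  refine Ideal.add_mem _ ?_ ?_
  · rw [add_assoc, pow_add]
    exact Ideal.mul_mem_mul hx.1 hy.2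
  · rw [add_right_comm, pow_add]
    exact Ideal.mul_mem_mul hx.2 hy.right_mem

theorem LeadEq.refl {p : ℕ} {x : MvPowerSeries (Fin n) K} (hx : x ∈ 𝔪 ^ p) : LeadEq p x x :=
  ⟨hx, by rw [sub_self]; exact Ideal.zero_mem _⟩

theorem LeadEq.pow {p : ℕ} {x x' : MvPowerSeries (Fin n) K} (hx : LeadEq p x x') (d : ℕ) :
    LeadEq (d * p) (x ^ d) (x' ^ d) := by
  induction d with
  | zero => simpa using LeadEq.refl (p := 0) (x := (1 : MvPowerSeries (Fin n) K)) (by simp)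
  | succ d ih => rw [add_mul, one_mul, pow_succ, pow_succ]; exact ih.mul hx

theorem LeadEq.prod {ι : Type*} (s : Finset ι) (p : ι → ℕ) (x x' : ι → MvPowerSeries (Fin n) K)
    (h : ∀ i ∈ s, LeadEq (p i) (x i) (x' i)) :
    LeadEq (∑ i ∈ s, p i) (∏ i ∈ s, x i) (∏ i ∈ s, x' i) := by
  classical
  induction s using Finset.induction_on with
  | empty => simpa using LeadEq.refl (p := 0) (x := (1 : MvPowerSeries (Fin n) K)) (by simp)
  | insert a s ha ih =>
    rw [Finset.sum_insert ha, Finset.prod_insert ha, Finset.prod_insert ha]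
    exact (h a (Finset.mem_insert_self a s)).mul (ih fun i hi => h i (Finset.mem_insert_of_mem hi))

theorem LeadEq.sum {ι : Type*} (s : Finset ι) (p : ℕ) (x x' : ι → MvPowerSeries (Fin n) K)
    (h : ∀ i ∈ s, LeadEq p (x i) (x' i)) : LeadEq p (∑ i ∈ s, x i) (∑ i ∈ s, x' i) :=
  ⟨Ideal.sum_mem _ fun i hi => (h i hi).1, by
    rw [← Finset.sum_sub_distrib]; exact Ideal.sum_mem _ fun i hi => (h i hi).2⟩

theorem monomial_eq_C_mul_prod (e : Fin n →₀ ℕ) (c : K) :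
    (MvPowerSeries.monomial e c : MvPowerSeries (Fin n) K) =
      MvPowerSeries.C c * ∏ i, MvPowerSeries.X i ^ e i := by
  rw [← MvPolynomial.coe_monomial, MvPolynomial.monomial_eq, Finsupp.prod_fintype _ _ (by simp)]
  rw [← MvPolynomial.coeToMvPowerSeries.ringHom_apply, map_mul, map_prod]
  simp

/-- The linear substitution `x_i ↦ ∑ j, g i j * x_j` applied to the form of degree `m` with
coefficients `a`, over any ring. -/
def linSubst {R : Type*} [CommRing R] {m : ℕ} (a : HomExp n m → R) (g : Fin n × Fin n → R) :
    MvPolynomial (Fin n) R :=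
  ∑ e, MvPolynomial.C (a e) * ∏ i, (∑ j, MvPolynomial.C (g (i, j)) * X j) ^ e.1 i

theorem map_linSubst {R S : Type*} [CommRing R] [CommRing S] (φ : R →+* S) {m : ℕ}
    (a : HomExp n m → R) (g : Fin n × Fin n → R) :
    MvPolynomial.map φ (linSubst a g) = linSubst (φ ∘ a) (φ ∘ g) := by
  simp [linSubst]

/-- The coefficients of `linSubst`, as polynomials in the coefficients of the form and of the
linear substitution. -/
def substPoly (n : ℕ) (K : Type*) [Field K] (m : ℕ) (d : HomExp n m) :
    MvPolynomial (HomExp n m ⊕ (Fin n × Fin n)) K :=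
  MvPolynomial.coeff d.1 (linSubst (fun e => X (Sum.inl e)) fun p => X (Sum.inr p))

theorem eval_substPoly {m : ℕ} (a : HomExp n m → K) (g : Fin n × Fin n → K) (d : HomExp n m) :
    eval (Sum.elim a g) (substPoly n K m d) = MvPolynomial.coeff d.1 (linSubst a g) := by
  rw [substPoly, ← MvPolynomial.coeff_map, map_linSubst]
  congr 2 <;> ext <;> simp

theorem leadEq_linear {x : MvPowerSeries (Fin n) K} (hx : x ∈ 𝔪) :
    LeadEq 1 x (∑ j, MvPowerSeries.C (MvPowerSeries.coeff
        (Finsupp.single j 1) x) * MvPowerSeries.X j) := by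
  classical
  rw [← pow_one 𝔪] at hx
  refine ⟨hx, mem_maximalIdeal_pow_iff.2 fun d hd => ?_⟩
  rw [map_sub, map_sum]
  simp_rw [MvPowerSeries.coeff_C_mul, MvPowerSeries.coeff_X]
  by_cases h : d.degree = 1
  · obtain ⟨i, rfl⟩ : ∃ i, d = Finsupp.single i 1 := by
      obtain ⟨i, hi⟩ := (Finsupp.range_single_one.symm.subset h : d ∈ Set.range fun i :
          Fin n => Finsupp.single i 1)
      exact ⟨i, hi.symm⟩
    rw [Finset.sum_eq_single i]
    · simp
    · intro j _ hj
      rw [if_neg, mul_zero]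
      intro h
      exact hj (Finsupp.single_left_injective one_ne_zero h).symm
    · simp
  · rw [mem_maximalIdeal_pow_iff.1 hx d (by omega), zero_sub, neg_eq_zero]
    refine Finset.sum_eq_zero fun j _ => ?_
    rw [if_neg, mul_zero]
    rintro rfl
    exact h (Finsupp.degree_single _ _)

/-- Only the linear parts of the `Φ (X i)` affect the leading form. By homogeneity of degree `m`,
the constant term `c ^ m` of `u` is absorbed by multiplying these linear parts by `c`. The
parameters `g` do not depend on the series being transformed. -/
theorem unit_mul_right_form {m : ℕ} (Φ : RightGroup n K) (u : MvPowerSeries (Fin n) K) (c : K)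
    (hu : MvPowerSeries.constantCoeff u = c ^ m) :
    ∃ g : Fin n × Fin n → K, ∀ a : HomExp n m → K, ∀ h ∈ 𝔪 ^ (m + 1),
      ∃ h' ∈ 𝔪 ^ (m + 1), u * Φ (form a + h) =
        form (fun d => eval (Sum.elim a g) (substPoly n K m d)) + h' := by
  let g₀ : Fin n × Fin n → K := fun p => MvPowerSeries.coeff (Finsupp.single p.2 1) (Φ
      (MvPowerSeries.X p.1))
  refine ⟨fun p => c * g₀ p, fun a h hh => ?_⟩
  set Q := linSubst a (fun p => c * g₀ p) with hQ
  have hΦX : ∀ i, Φ (MvPowerSeries.X i) ∈ 𝔪 := fun i => by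
    have := right_mem_pow Φ 1 (f := MvPowerSeries.X i) (by rw [pow_one]; exact X_mem_maximalIdeal i)
    rwa [pow_one] at this
  have hu' : LeadEq 0 u (MvPowerSeries.C (c ^ m)) := by
    refine ⟨by simp, ?_⟩
    rw [zero_add, pow_one, mem_maximalIdeal_iff_constantCoeff, map_sub, hu,
        MvPowerSeries.constantCoeff_C,
      sub_self]
  have h1 : LeadEq m (u * Φ (form a)) (Q : MvPowerSeries (Fin n) K) := by
    have e1 : u * Φ (form a) = ∑ e : HomExp n m, u * (MvPowerSeries.C (a e) * ∏ i, Φ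
        (MvPowerSeries.X i) ^ e.1 i) := by
      change u * Φ (∑ e : HomExp n m, MvPowerSeries.monomial e.1 (a e)) = _
      rw [map_sum, Finset.mul_sum]
      refine Finset.sum_congr rfl fun e _ => ?_
      rw [monomial_eq_C_mul_prod, map_mul, map_prod]
      simp_rw [map_pow]
      congr 2
      exact Φ.commutes (a e)
    have e2 : (Q : MvPowerSeries (Fin n) K) = ∑ e : HomExp n m, MvPowerSeries.C (c ^ m) *
        (MvPowerSeries.C (a e) * ∏ i, (∑ j, MvPowerSeries.C (g₀
            (i, j)) * MvPowerSeries.X j) ^ e.1 i) := by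
      rw [hQ, linSubst, ← MvPolynomial.coeToMvPowerSeries.ringHom_apply, map_sum]
      refine Finset.sum_congr rfl fun e _ => ?_
      have hlin : ∀ i, MvPolynomial.coeToMvPowerSeries.ringHom
          (∑ j, MvPolynomial.C (c * g₀ (i, j)) * X j : MvPolynomial (Fin n) K) =
          MvPowerSeries.C c * ∑ j, MvPowerSeries.C (g₀ (i, j)) * MvPowerSeries.X j := fun i => by
        rw [map_sum, Finset.mul_sum]
        refine Finset.sum_congr rfl fun j _ => ?_
        rw [map_mul, MvPolynomial.coeToMvPowerSeries.ringHom_apply,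
          MvPolynomial.coeToMvPowerSeries.ringHom_apply, MvPolynomial.coe_C, MvPolynomial.coe_X,
          map_mul, mul_assoc]
      rw [map_mul, map_prod, MvPolynomial.coeToMvPowerSeries.ringHom_apply, MvPolynomial.coe_C]
      simp_rw [fun i => map_pow (MvPolynomial.coeToMvPowerSeries.ringHom (σ := Fin n) (R := K))
        (∑ j, MvPolynomial.C (c * g₀ (i, j)) * X j) (e.1 i), hlin, mul_pow]
      rw [Finset.prod_mul_distrib, Finset.prod_pow_eq_pow_sum, ← Finsupp.degree_eq_sum, e.2,
          map_pow]
      ring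
    rw [e1, e2]
    refine LeadEq.sum _ _ _ _ fun e _ => ?_
    have := hu'.mul ((LeadEq.refl (p := 0) (x := (MvPowerSeries.C (a e) :
        MvPowerSeries (Fin n) K)) (by simp)).mul
      (LeadEq.prod Finset.univ _ _ _ fun i _ => (leadEq_linear (hΦX i)).pow (e.1 i)))
    simp only [mul_one, zero_add] at this
    rw [← Finsupp.degree_eq_sum, e.2] at this
    exact this
  have h2 : u * Φ (form a + h) - Q ∈ 𝔪 ^ (m + 1) := by
    rw [map_add, mul_add, add_sub_right_comm]
    exact Ideal.add_mem _ h1.2 (Ideal.mul_mem_left _ _ (right_mem_pow Φ _ hh))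
  refine ⟨_, ?_, (add_sub_cancel _ _).symm⟩
  rw [← sub_add_sub_cancel _ (Q : MvPowerSeries (Fin n) K)]
  refine Ideal.add_mem _ h2 ?_
  have := sub_form_mem h1.right_mem
  simp_rw [MvPolynomial.coeff_coe] at this
  simp_rw [eval_substPoly]
  exact this

end PowerSeries

/-! ### Dimension and irreducibility in topological spaces. -/

section Topology

theorem Topology.IsInducing.topologicalKrullDim_closure_le {X Y : Type*} [TopologicalSpace X]
    [TopologicalSpace Y] {f : X → Y} (hf : IsInducing f) (S : Set X) :
    topologicalKrullDim (closure S) ≤ topologicalKrullDim (closure (f '' S)) := by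
  have hmap : Set.MapsTo f (closure S) (closure (f '' S)) :=
    (Set.mapsTo_image f S).closure hf.continuous
  have : IsInducing (hmap.restrict f _ _) := by
    have h : IsInducing (Subtype.val ∘ hmap.restrict f _ _) := hf.comp IsInducing.subtypeVal
    exact h.of_comp (by exact (hf.continuous.comp continuous_subtype_val).subtype_mk _)
        continuous_subtype_val
  exact this.topologicalKrullDim_le

theorem Topology.IsClosedEmbedding.topologicalKrullDim_closure_eq {X Y : Type*} [TopologicalSpace X]
    [TopologicalSpace Y] {f : X → Y} (hf : IsClosedEmbedding f) (S : Set X) :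
    topologicalKrullDim (closure (f '' S)) = topologicalKrullDim (closure S) := by
  rw [hf.closure_image_eq]
  exact (hf.isEmbedding.homeomorphImage (closure S)).isHomeomorph.topologicalKrullDim_eq.symm

theorem topologicalKrullDim_closure_mono {X : Type*} [TopologicalSpace X] {S T : Set X}
    (h : S ⊆ closure T) : topologicalKrullDim (closure S) ≤ topologicalKrullDim (closure T) :=
  (Topology.IsEmbedding.inclusion (closure_minimal h
      isClosed_closure)).isInducing.topologicalKrullDim_le

theorem topologicalKrullDim_nonneg {X : Type*} [TopologicalSpace X] [Nonempty X] :
    0 ≤ topologicalKrullDim X := by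
  have : Nonempty (TopologicalSpace.IrreducibleCloseds X) :=
    ⟨⟨closure {Classical.arbitrary X}, isIrreducible_singleton.closure, isClosed_closure⟩⟩
  exact Order.krullDim_nonneg

theorem IsIrreducible.subset_of_subset_iUnion {X ι : Type*} [TopologicalSpace X] [Finite ι] {S :
    Set X}
    (hS : IsIrreducible S) {Z : ι → Set X} (hZ : ∀ i, IsClosed (Z i)) (h : S ⊆ ⋃ i, Z i) :
    ∃ i, S ⊆ Z i := by
  classical
  have := Fintype.ofFinite ι
  obtain ⟨_, hz, hSz⟩ := isIrreducible_iff_sUnion_isClosed.1 hS (Finset.univ.image Z)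
    (by simpa using hZ) (by simpa using h)
  obtain ⟨i, -, rfl⟩ := Finset.mem_image.1 hz
  exact ⟨i, hSz⟩

theorem dimToEReal_natCast (a : ℕ) : dimToEReal a = ((a : ℝ) : EReal) := rfl

theorem dimToEReal_cases {p : WithBot ℕ∞ → Prop} (hb : p ⊥) (ht : p ⊤) (hn : ∀ a : ℕ, p a) (t) :
    p t := by
  induction t using WithBot.recBotCoe with
  | bot => exact hb
  | coe t =>
    induction t using ENat.recTopCoe with
    | top => exact ht
    | coe a => exact hn a

theorem natCast_sub_le_dimToEReal {a c : ℕ} (t : WithBot ℕ∞) (h : (a : WithBot ℕ∞) ≤ t + c) :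
    (((a : ℝ) - (c : ℝ) : ℝ) : EReal) ≤ dimToEReal t := by
  induction t using dimToEReal_cases with
  | hb => simp at h
  | ht => exact le_top
  | hn b =>
    rw [dimToEReal_natCast, EReal.coe_le_coe_iff]
    have : a ≤ b + c := by exact_mod_cast h
    have : (a : ℝ) ≤ b + c := by exact_mod_cast this
    linarith

theorem exists_dimToEReal_eq {a : ℕ} (t : WithBot ℕ∞) (h0 : 0 ≤ t) (h : t ≤ a) :
    ∃ i : ℕ, i ≤ a ∧ dimToEReal t = ((i : ℝ) : EReal) := by
  induction t using dimToEReal_cases with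
  | hb => simp at h0
  | ht => exact absurd h (WithBot.coe_lt_coe.2 (ENat.natCast_lt_top a)).not_ge
  | hn b => exact ⟨b, by exact_mod_cast h, rfl⟩

/-- `orbitDimSet` only admits points whose local orbit dimension is a natural number. This excludes
infinite values and supplies the bound that leaves finitely many cases. -/
theorem exists_dimAt_eq {X : Type*} [TopologicalSpace X] {W : Set X} {x : X} (hx : x ∈ W) {a : ℕ}
    (ha : ∀ S ⊆ W, topologicalKrullDim (closure S) ≤ a) :
    ∃ i : ℕ, i ≤ a ∧ dimAt W x = ((i : ℝ) : EReal) := by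
  have key : ∀ Z : Set W, Z.Nonempty → ∃ i : ℕ, i ≤ a ∧ setDim (Subtype.val '' Z) = ((i : ℝ) :
      EReal) := by
    intro Z hZ
    have : Nonempty (closure (Subtype.val '' Z)) := (hZ.image _).closure.to_subtype
    exact exists_dimToEReal_eq _ topologicalKrullDim_nonneg (ha _ (Subtype.coe_image_subset W Z))
  let I : Set ℕ := {i | ∃ Z : Set W, (Z ∈ irreducibleComponents W ∧ x ∈ Subtype.val '' Z) ∧
    setDim (Subtype.val '' Z) = ((i : ℝ) : EReal)}
  have hIne : I.Nonempty := by
    have hmem : (⟨x, hx⟩ : W) ∈ irreducibleComponent (⟨x, hx⟩ : W) := mem_irreducibleComponent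
    obtain ⟨i, -, hi⟩ := key (irreducibleComponent (⟨x, hx⟩ : W)) ⟨_, hmem⟩
    exact ⟨i, _, ⟨irreducibleComponent_mem_irreducibleComponents _, _, hmem, rfl⟩, hi⟩
  have hIb : ∀ i ∈ I, i ≤ a := by
    rintro i ⟨Z, ⟨-, z, hz, -⟩, hi⟩
    obtain ⟨j, hj, hj'⟩ := key Z ⟨z, hz⟩
    rw [hi, EReal.coe_eq_coe_iff, Nat.cast_inj] at hj'
    exact hj' ▸ hj
  have hmax := Nat.sSup_mem hIne ⟨a, hIb⟩
  refine ⟨sSup I, hIb _ hmax, le_antisymm (iSup₂_le fun Z hZ => ?_) ?_⟩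
  · obtain ⟨z, hz, -⟩ := hZ.2
    obtain ⟨j, hj, hj'⟩ := key Z ⟨z, hz⟩
    rw [hj', EReal.coe_le_coe_iff, Nat.cast_le]
    exact le_csSup ⟨a, hIb⟩ ⟨Z, hZ, hj'⟩
  · obtain ⟨Z, hZ, hi⟩ := hmax
    rw [← hi]
    exact le_iSup₂_of_le Z hZ le_rfl

theorem continuous_eval_polynomials {K : Type*} [Field K] {σ α : Type*} [Finite σ] [Finite α]
    (P : σ → MvPolynomial α K) : Continuous fun (a : α → K) i => eval a (P i) := by
  refine continuous_zariski fun l => ?_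
  obtain ⟨Q, hQ⟩ := mem_polyFun_pi.1 (dual_mem_polyFun l)
  refine mem_polyFun_pi.2 ⟨bind₁ P Q, ?_⟩
  ext a
  have := congrFun hQ fun i => eval a (P i)
  beta_reduce at this ⊢
  rw [this]
  change aeval _ Q = aeval a (aeval P Q)
  rw [MvPolynomial.comp_aeval_apply]
  rfl

theorem isIrreducible_univ_piZariski {K : Type*} [Field K] [IsAlgClosed K] {σ : Type*} [Finite σ] :
    IsIrreducible (Set.univ : Set (σ → K)) := by
  have := isIrreducible_zeroLocus (⊥ : Ideal (MvPolynomial σ K))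
  rwa [zeroLocus_bot] at this

end Topology

/-! ### Linear coordinates on jet spaces. -/

section Jets

variable {n : ℕ} {K : Type u} [Field K]

local notation "𝔪" => IsLocalRing.maximalIdeal (MvPowerSeries (Fin n) K)

/-- The exponents of the monomials of degree at most `k` in `n` variables. -/
abbrev JetExp (n k : ℕ) : Type := {e : Fin n →₀ ℕ // e.degree ≤ k}

instance (n k : ℕ) : Finite (JetExp n k) := (Finsupp.finite_of_degree_le (σ := Fin n) k).to_subtype

instance (n k : ℕ) : Fintype (JetExp n k) := Fintype.ofFinite _

/-- The power series of degree at most `k` with given coefficients. -/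
def truncSeries {k : ℕ} : (JetExp n k → K) →ₗ[K] MvPowerSeries (Fin n) K where
  toFun a := ∑ e, MvPowerSeries.monomial e.1 (a e)
  map_add' a b := by simp [Finset.sum_add_distrib]
  map_smul' c a := by
    rw [Finset.smul_sum]
    exact Finset.sum_congr rfl fun e _ => map_smul (MvPowerSeries.monomial e.1) c (a e)

theorem coeff_truncSeries {k : ℕ} (a : JetExp n k → K) (d : JetExp n k) :
    MvPowerSeries.coeff d.1 (truncSeries a) = a d := by
  classical
  change MvPowerSeries.coeff d.1 (∑ e : JetExp n k, MvPowerSeries.monomial e.1 (a e)) = _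
  rw [map_sum]
  simp_rw [MvPowerSeries.coeff_monomial]
  rw [Finset.sum_eq_single d]
  · simp
  · rintro e - he
    exact if_neg fun hd => he (Subtype.ext hd.symm)
  · simp

theorem jet_eq_jet_iff_coeff {k : ℕ} {f g : MvPowerSeries (Fin n) K} : jet k f = jet k g ↔
    ∀ d : JetExp n k, MvPowerSeries.coeff d.1 f = MvPowerSeries.coeff d.1 g := by
  rw [jet_eq_jet_iff, mem_maximalIdeal_pow_iff]
  simp_rw [map_sub, sub_eq_zero, Nat.lt_succ_iff, Subtype.forall]

/-- The coefficients, as linear coordinates on the jet space. -/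
def jetCoord (n : ℕ) (K : Type u) [Field K] (k : ℕ) : JetSpace n K k ≃ₗ[K] (JetExp n k → K) :=
  (LinearEquiv.ofBijective ((jet k).toLinearMap ∘ₗ truncSeries (n := n) (K := K) (k :=
      k)) ⟨fun a b hab => by
    ext d
    have := jet_eq_jet_iff_coeff.1 hab d
    rwa [coeff_truncSeries, coeff_truncSeries] at this, fun x => by
    obtain ⟨f, rfl⟩ := jet_surjective k x
    exact ⟨fun d => MvPowerSeries.coeff d.1 f,
      jet_eq_jet_iff_coeff.2 fun d => coeff_truncSeries _ d⟩⟩).symm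

theorem jetCoord_jet {k : ℕ} (f : MvPowerSeries (Fin n) K) (d : JetExp n k) :
    jetCoord n K k (jet k f) d = MvPowerSeries.coeff d.1 f := by
  have : jetCoord n K k (jet k f) = fun d => MvPowerSeries.coeff d.1 f := by
    rw [jetCoord, LinearEquiv.symm_apply_eq]
    exact (jet_eq_jet_iff_coeff.2 fun d => coeff_truncSeries _ d).symm
  rw [this]

theorem isHomeomorph_jetCoord (n : ℕ) (K : Type u) [Field K] (k : ℕ) :
    IsHomeomorph (jetCoord n K k) :=
  isHomeomorph_zariski_linearEquiv (jetCoord n K k)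

/-- The group acts on the jets of order at least `m` in such a way that the leading form of a
transform depends polynomially on the leading form and on finitely many parameters. -/
def ActsOnLeadingForms (G : Type*) [Group G] (k : ℕ) [MulAction G (JetSpace n K k)] {m : ℕ}
    {κ : Type} (F : HomExp n m → MvPolynomial (HomExp n m ⊕ κ) K) : Prop :=
  ∀ (g : G) (a : HomExp n m → K), ∀ h ∈ 𝔪 ^ (m + 1), ∃ b : κ → K, ∃ h' ∈ 𝔪 ^ (m + 1),
    g • jet k (form a + h) = jet k (form (fun d => eval (Sum.elim a b) (F d)) + h')

theorem form_eq_of_jet_eq {m k : ℕ} (hmk : m ≤ k) {a b : HomExp n m → K} {h h' :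
    MvPowerSeries (Fin n) K}
    (hh : h ∈ 𝔪 ^ (m + 1)) (hh' : h' ∈ 𝔪 ^ (m + 1)) (e : jet k (form a + h) = jet k (form b + h')) :
    a = b := by
  ext d
  have := jet_eq_jet_iff_coeff.1 e ⟨d.1, d.2.trans_le hmk⟩
  rwa [map_add, map_add, coeff_form, coeff_form, dif_pos d.2, dif_pos d.2,
    mem_maximalIdeal_pow_iff.1 hh d.1 (d.2.trans_lt m.lt_succ_self),
    mem_maximalIdeal_pow_iff.1 hh' d.1 (d.2.trans_lt m.lt_succ_self), add_zero, add_zero] at this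

end Jets

/-! ### Lower bounds for the two versions of modality. -/

section Modality

variable {n : ℕ} {K : Type u} [Field K]

local notation "𝔪" => IsLocalRing.maximalIdeal (MvPowerSeries (Fin n) K)

/-- The exponents of degree `d` with `m < d ≤ k`. -/
abbrev HighExp (n m k : ℕ) : Type := {e : JetExp n k // m < e.1.degree}

/-- The coordinates of a jet of order at least `m`, as polynomials in the coefficients of its
leading form and in those of higher degree. -/
def jetParam {m k : ℕ} {α : Type} (A : HomExp n m → MvPolynomial α K) (B : HighExp n m k → α)
    (d : JetExp n k) : MvPolynomial α K :=
  if h : d.1.degree = m then A ⟨d.1, h⟩ else if h : m < d.1.degree then X (B ⟨d, h⟩) else 0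

theorem jetCoord_jet_form_add {m k : ℕ} {α : Type} (A : HomExp n m → MvPolynomial α K)
    (B : HighExp n m k → α) (v : α → K) {h : MvPowerSeries (Fin n) K} (hh : h ∈ 𝔪 ^ (m + 1))
    (hv : ∀ e : HighExp n m k, v (B e) = MvPowerSeries.coeff e.1.1 h) :
    jetCoord n K k (jet k (form (fun d => eval v (A d)) + h)) = fun d => eval v (jetParam A B d) :=
        by
  ext d
  rw [jetCoord_jet, map_add, coeff_form, jetParam]
  rcases lt_trichotomy m d.1.degree with hd | hd | hd
  · rw [dif_neg hd.ne', dif_neg hd.ne', dif_pos hd, eval_X, hv, zero_add]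
  · rw [dif_pos hd.symm, dif_pos hd.symm, mem_maximalIdeal_pow_iff.1 hh d.1 (by omega), add_zero]
  · rw [dif_neg hd.ne, dif_neg hd.ne, dif_neg hd.not_gt, map_zero,
      mem_maximalIdeal_pow_iff.1 hh d.1 (by omega), add_zero]

variable [IsAlgClosed K]

/-- The `E` coefficients of degree above `m` enter both the dimension of the space of jets of order
at least `m` and the bound for its orbits, so they cancel in the difference. -/
theorem le_gPar {m k : ℕ} (hmk : m ≤ k) {f : MvPowerSeries (Fin n) K} (hf : f ∈ 𝔪 ^ m) (G : Type*)
    [Group G] [MulAction G (JetSpace n K k)] {κ : Type} [Finite κ]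
    (F : HomExp n m → MvPolynomial (HomExp n m ⊕ κ) K) (hF : ActsOnLeadingForms G k F) :
    (((Nat.card (HomExp n m) : ℝ) - (Nat.card κ : ℝ) : ℝ) : EReal) ≤ gPar G (jet k f) := by
  have hcoord := isHomeomorph_jetCoord n K k
  refine le_iInf₂ fun U ⟨hU, hfU⟩ => ?_
  set E := Nat.card (HighExp n m k) with hE
  -- the linear subspace of jets of order at least `m`
  let P : JetExp n k → MvPolynomial (HomExp n m ⊕ HighExp n m k) K :=
    jetParam (fun e => X (Sum.inl e)) Sum.inr
  let T : Set (JetExp n k → K) := Set.range fun (v :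
      HomExp n m ⊕ HighExp n m k → K) d => eval v (P d)
  have hT : IsIrreducible T := by
    have : T = (fun (v : HomExp n m ⊕ HighExp n m k → K) d => eval v (P d)) '' Set.univ :=
      Set.image_univ.symm
    rw [this]
    exact isIrreducible_univ_piZariski.image _ (continuous_eval_polynomials P).continuousOn
  let V : Set (JetSpace n K k) := (jetCoord n K k) ⁻¹' T
  have hVT : jetCoord n K k '' V = T := Set.image_preimage_eq _ (jetCoord n K k).surjective
  have hVirr : IsIrreducible V := by
    have : V = (hcoord.homeomorph _).symm '' T := by
      rw [Homeomorph.image_symm]; rfl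
    rw [this]
    exact hT.image _ (hcoord.homeomorph _).symm.continuous.continuousOn
  have hV : ∀ g ∈ 𝔪 ^ m, jet k g ∈ V := fun g hg => by
    refine ⟨Sum.elim (fun e => MvPowerSeries.coeff e.1 g) (fun e =>
        MvPowerSeries.coeff e.1.1 g), ?_⟩
    have h := jetCoord_jet_form_add (k := k) (fun e => X (Sum.inl e)) (Sum.inr : HighExp n m k → _)
      (Sum.elim (fun e => MvPowerSeries.coeff e.1 g) (fun e => MvPowerSeries.coeff e.1.1 g))
      (sub_form_mem hg) fun e => by
        rw [Sum.elim_inr, map_sub, coeff_form, dif_neg e.2.ne', sub_zero]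
    simp only [eval_X, Sum.elim_inl, add_sub_cancel] at h
    exact h.symm
  have hdimV : ((Nat.card (HomExp n m) + E : ℕ) : WithBot ℕ∞) ≤ topologicalKrullDim (closure V) :=
      by
    rw [← hcoord.isClosedEmbedding.topologicalKrullDim_closure_eq, hVT]
    -- With `H = 1` and no fibre parameters: the parametrization of `T` is injective, its parameters
    -- being jet coordinates.
    have h := card_le_topologicalKrullDim_closure_add (κ := Empty) (1 :
        MvPolynomial (HomExp n m ⊕ HighExp n m k) K)
      one_ne_zero P (fun i => X (Sum.inl i)) (fun a b _ _ hab => ⟨Empty.elim, ?_⟩)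
      (FractionRing (MvPolynomial (HomExp n m ⊕ HighExp n m k) K)) (S := T)
      (fun a _ => ⟨a, by simp⟩)
    · simpa [hE] using h
    · rintro (e | e)
      · have := hab ⟨e.1, e.2.trans_le hmk⟩
        simpa [P, jetParam, e.2] using this
      · have := hab e.1
        simpa [P, jetParam, e.2, e.2.ne'] using this
  have horb : ∀ y ∈ V ∩ U, ∃ i : Fin (Nat.card κ + E + 1), y ∈ orbitDimSet G U i := by
    rintro y ⟨hyV, hyU⟩
    obtain ⟨v, hv⟩ := hyV
    obtain ⟨g, rfl⟩ := jet_surjective k y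
    have hg : ∀ d : JetExp n k, d.1.degree < m → MvPowerSeries.coeff d.1 g = 0 := fun d hd => by
      rw [← jetCoord_jet, ← hv]
      simp only [P, jetParam, dif_neg hd.ne, dif_neg hd.not_gt, map_zero]
    have hg : g ∈ 𝔪 ^ m := mem_maximalIdeal_pow_iff.2 fun d hd => hg ⟨d, by omega⟩ hd
    let a : HomExp n m → K := fun e => MvPowerSeries.coeff e.1 g
    -- The leading form is frozen at that of `g`. The orbit is then parametrized by `κ` and the
    -- coefficients of degree above `m`.
    let A : HomExp n m → MvPolynomial (κ ⊕ HighExp n m k) K := fun e =>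
      aeval (Sum.elim (fun i => MvPolynomial.C (a i)) fun i => X (Sum.inl i)) (F e)
    have hA : ∀ b c e, eval (Sum.elim b c) (A e) = eval (Sum.elim a b) (F e) := fun b c e => by
      change aeval (Sum.elim b c) (aeval _ (F e)) = aeval (Sum.elim a b) (F e)
      rw [MvPolynomial.comp_aeval_apply]
      congr 2
      ext (i | i) <;> simp
    let Q := jetParam (k := k) A Sum.inr
    have hQ : ∀ y' ∈ MulAction.orbit G (jet k g), jetCoord n K k y' ∈
        Set.range fun (v : κ ⊕ HighExp n m k → K) d => eval v (Q d) := by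
      rintro _ ⟨γ, rfl⟩
      obtain ⟨b, h', hh', e⟩ := hF γ a _ (sub_form_mem hg)
      rw [add_sub_cancel] at e
      refine ⟨Sum.elim b (fun e => MvPowerSeries.coeff e.1.1 h'), ?_⟩
      have h := jetCoord_jet_form_add A Sum.inr (Sum.elim b fun e =>
          MvPowerSeries.coeff e.1.1 h') hh'
        fun _ => rfl
      simp_rw [hA] at h
      beta_reduce
      rw [e, h]
    obtain ⟨i, hi, hi'⟩ := exists_dimAt_eq (W := U ∩ MulAction.orbit G (jet k g)) (x := jet k g)
      ⟨hyU, MulAction.mem_orbit_self _⟩ (a := Nat.card κ + E) fun S hS => by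
        rw [← hcoord.isClosedEmbedding.topologicalKrullDim_closure_eq]
        refine (topologicalKrullDim_closure_le_of_subset_range Q ?_).trans (by simp [hE])
        rintro _ ⟨s, hs, rfl⟩
        exact hQ s (hS hs).2
    exact ⟨⟨i, by omega⟩, hyU, hi'⟩
  -- By irreducibility one member of this finite closed cover contains `V`. It is not the complement
  -- of `U`, since `jet k f` lies in both `V` and `U`.
  obtain ⟨i, hi⟩ := hVirr.subset_of_subset_iUnion (ι := Option (Fin (Nat.card κ + E + 1)))
    (Z := fun o => o.elim Uᶜ fun i => closure (orbitDimSet G U i))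
    (fun o => by
      cases o with
      | none => exact hU.isClosed_compl
      | some i => exact isClosed_closure)
    (fun y hy => by
      by_cases hyU : y ∈ U
      · obtain ⟨i, hi⟩ := horb y ⟨hy, hyU⟩
        exact Set.mem_iUnion.2 ⟨some i, subset_closure hi⟩
      · exact Set.mem_iUnion.2 ⟨none, hyU⟩)
  cases i with
  | none => exact absurd hfU (hi (hV f hf))
  | some i =>
    have h1 := hdimV.trans (topologicalKrullDim_closure_mono hi)
    have h2 : (((Nat.card (HomExp n m) + E : ℕ) : ℝ) : EReal) ≤ setDim (orbitDimSet G U i) := by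
      have h2 := natCast_sub_le_dimToEReal (a := Nat.card (HomExp n m) + E) (c := 0)
        (topologicalKrullDim (closure (orbitDimSet G U i)))
        (by rw [Nat.cast_zero, add_zero]; exact h1)
      rwa [Nat.cast_zero, sub_zero] at h2
    refine le_trans ?_ ((EReal.sub_le_sub h2 le_rfl).trans (le_iSup (fun i : ℕ =>
      setDim (orbitDimSet G U i) - ((i : ℝ) : EReal)) i))
    rw [← EReal.coe_sub, EReal.coe_le_coe_iff]
    have : ((i : ℕ) : ℝ) ≤ Nat.card κ + E := by exact_mod_cast Nat.lt_succ_iff.1 i.2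
    push_cast
    linarith

/-- By irreducibility some preimage is dense. Being locally closed as well, it is open: the closed
set in its description pulls back to the whole space. -/
theorem exists_isOpen_preimage {X Y ι : Type*} [TopologicalSpace X] [TopologicalSpace Y] [Finite ι]
    (hX : IsIrreducible (Set.univ : Set X)) {σ : X → Y} (hσ : Continuous σ) (T : ι → Set Y)
    (hT : ∀ i, IsLocallyClosed (T i)) (hcover : ⋃ i, T i = Set.univ) :
    ∃ i, IsOpen (σ ⁻¹' T i) ∧ (σ ⁻¹' T i).Nonempty := by
  obtain ⟨i, hi⟩ := hX.subset_of_subset_iUnion (Z := fun i => closure (σ ⁻¹' T i))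
    (fun _ => isClosed_closure) fun x _ => by
      obtain ⟨i, hi⟩ := Set.mem_iUnion.1 (hcover.symm.subset (Set.mem_univ (σ x)))
      exact Set.mem_iUnion.2 ⟨i, subset_closure hi⟩
  refine ⟨i, ?_, closure_nonempty_iff.1 (hX.1.mono hi)⟩
  obtain ⟨O, C, hO, hC, h⟩ := hT i
  have hCu : σ ⁻¹' C = Set.univ := Set.univ_subset_iff.1 (hi.trans (closure_minimal
    (Set.preimage_mono (h.subset.trans Set.inter_subset_right)) (hC.preimage hσ)))
  rw [h, Set.preimage_inter, hCu, Set.inter_univ]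
  exact hO.preimage hσ

/-- The fibre inequality is applied to the quotient map, read in an affine chart, along the slice
that varies only the leading form of `f`. -/
theorem le_gMod {m k : ℕ} (hmk : m ≤ k) {f : MvPowerSeries (Fin n) K} (hf : f ∈ 𝔪 ^ m) (G : Type*)
    [Group G] [MulAction G (JetSpace n K k)] {κ : Type} [Finite κ]
    (F : HomExp n m → MvPolynomial (HomExp n m ⊕ κ) K) (hF : ActsOnLeadingForms G k F)
    (S : RosenlichtStratification n K k G) :
    (((Nat.card (HomExp n m) : ℝ) - (Nat.card κ : ℝ) : ℝ) : EReal) ≤ gMod S (jet k f) := by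
  classical
  refine le_iInf₂ fun U ⟨hU, hfU⟩ => ?_
  let a₀ : HomExp n m → K := fun e => MvPowerSeries.coeff e.1 f
  let σ : (HomExp n m → K) → JetSpace n K k := fun a => jet k (form a + (f - form a₀))
  have hσp : ∀ p ∈ polyFun K (JetSpace n K k), ∃ P : MvPolynomial (HomExp n m) K,
      ∀ a, p (σ a) = eval a P := by
    intro p hp
    obtain ⟨P, hP⟩ := mem_polyFun_pi.1 (polyFun_comp_mem (φ := σ) (fun l => by
      have e : (fun v => l (σ v)) = (fun v => (l ∘ₗ (jet k).toLinearMap ∘ₗ form) v) +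
          algebraMap K _ (l (jet k (f - form a₀))) := by
        ext v
        simp [σ]
      rw [e]
      exact add_mem (dual_mem_polyFun _) (Subalgebra.algebraMap_mem _ _)) hp)
    exact ⟨P, congrFun hP⟩
  have hσ : Continuous σ := by
    refine (zariski_isTopologicalBasis (K := K)).continuous_iff.2 ?_
    rintro _ ⟨p, hp, rfl⟩
    obtain ⟨P, hP⟩ := hσp p hp
    refine isOpen_piZariski_iff.2 fun x hx => ⟨P, hP x ▸ hx, fun y hy => ?_⟩
    change p (σ y) ≠ 0
    rwa [hP]
  have hirr := isIrreducible_univ_piZariski (K := K) (σ := HomExp n m)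
  obtain ⟨i, hiO, hine⟩ := exists_isOpen_preimage hirr hσ (fun i => (S.piece i :
      Set (JetSpace n K k)))
    S.isLocallyClosed S.cover
  have hUO : IsOpen (σ ⁻¹' U) := hU.preimage hσ
  -- Two nonempty open sets of an irreducible space meet; `a₀` witnesses the second, as its image
  -- under `σ` is `jet k f`. The form `b₀` serves as base point, since `a₀` itself may map to
  -- another stratum.
  obtain ⟨b₀, -, hb₁, hb₂⟩ := hirr.2 _ _ hiO hUO (by simpa using hine)
    ⟨a₀, Set.mem_univ _, by change jet k _ ∈ U; rwa [add_sub_cancel]⟩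
  set X := S.piece i with hX
  let y₀ : X := ⟨σ b₀, hb₁⟩
  obtain ⟨W, M, ψ, hyW, hψ⟩ := (S.isGeometricQuotient i).exists_chart (quotProj X y₀)
  -- the chart pulls back to rational functions near `b₀`
  have hreg : ∀ j : Fin M, ∃ Pj Qj : MvPolynomial (HomExp n m) K, eval b₀ Qj ≠ 0 ∧
      ∀ a (ha : σ a ∈ X), quotProj X ⟨σ a, ha⟩ ∈ W → eval a Qj ≠ 0 →
        ψ (quotProj X ⟨σ a, ha⟩) j = eval a Pj / eval a Qj := by
    intro j
    -- The coordinate functions of the ambient affine space are regular, so their pullbacks to the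
    -- stratum are local quotients of polynomials.
    have h := (hψ.regular_iff Set.univ (fun v => v j) isOpen_univ).1 (fun y _ =>
      ⟨fun v => v j, dual_mem_polyFun (LinearMap.proj j : (Fin M → K) →ₗ[K] K), 1, one_mem _,
        one_ne_zero, fun z _ _ => by simp⟩)
    obtain ⟨p, hp, q, hq, hq0, hpq⟩ := h y₀ ⟨hyW, Set.mem_univ _⟩
    obtain ⟨P, hP⟩ := hσp p hp
    obtain ⟨Q, hQ⟩ := hσp q hq
    refine ⟨P, Q, by rw [← hQ]; exact hq0, fun a ha haW haQ => ?_⟩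
    rw [← hP, ← hQ]
    exact hpq ⟨σ a, ha⟩ ⟨haW, Set.mem_univ _⟩ (by rw [← hQ] at haQ; exact haQ)
  choose Pj Qj hQ0 hPQ using hreg
  obtain ⟨O₂, hO₂, hWO₂⟩ : ∃ O₂ : Set (JetSpace n K k), IsOpen O₂ ∧ Subtype.val ⁻¹' O₂ = quotProj
      X ⁻¹' W :=
    hψ.isOpen.preimage continuous_quot_mk
  obtain ⟨H₀, hH₀, hH₀'⟩ := isOpen_piZariski_iff.1 ((hiO.inter hUO).inter (hO₂.preimage hσ)) b₀
    ⟨⟨hb₁, hb₂⟩, hWO₂.symm.subset (show y₀ ∈ quotProj X ⁻¹' W from hyW)⟩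
  -- `H₀ ≠ 0` keeps `σ a` in the stratum, in `U` and over the chart; the product of the `Qj` gives
  -- all chart coordinates a common denominator.
  let H : MvPolynomial (HomExp n m) K := H₀ * ∏ j, Qj j
  have hHdef : ∀ a, eval a H = eval a H₀ * ∏ j, eval a (Qj j) := fun a => by rw [map_mul, map_prod]
  have hH : H ≠ 0 := fun h => by
    have := hHdef b₀
    rw [h, map_zero] at this
    exact mul_ne_zero hH₀ (Finset.prod_ne_zero_iff.2 fun j _ => hQ0 j) this.symm
  let P : Fin M → MvPolynomial (HomExp n m) K := fun j =>
      Pj j * (H₀ * ∏ l ∈ Finset.univ.erase j, Qj l)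
  have hgood : ∀ a, eval a H ≠ 0 → ∃ ha : σ a ∈ X, σ a ∈ U ∧ quotProj X ⟨σ a, ha⟩ ∈ W ∧
      ψ (quotProj X ⟨σ a, ha⟩) = fun j => eval a (P j) / eval a H := by
    intro a ha
    rw [hHdef] at ha
    have h0 := left_ne_zero_of_mul ha
    have hQ : ∀ j, eval a (Qj j) ≠ 0 := fun j =>
      Finset.prod_ne_zero_iff.1 (right_ne_zero_of_mul ha) j (Finset.mem_univ j)
    obtain ⟨⟨h1, h2⟩, h3⟩ := hH₀' a h0
    have h3 : quotProj X ⟨σ a, h1⟩ ∈ W :=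
      hWO₂.subset (show (⟨σ a, h1⟩ : X) ∈ Subtype.val ⁻¹' O₂ from h3)
    refine ⟨h1, h2, h3, ?_⟩
    ext j
    rw [hPQ j a h1 h3 (hQ j), hHdef, ← Finset.mul_prod_erase _ _ (Finset.mem_univ j)]
    simp only [P, map_mul, map_prod]
    have hr : ∏ l ∈ Finset.univ.erase j, eval a (Qj l) ≠ 0 :=
      Finset.prod_ne_zero_iff.2 fun l _ => hQ l
    have := hQ j
    field_simp
  let T : Set (MulAction.orbitRel.Quotient G X) := quotProj X '' (Subtype.val ⁻¹' U)
  let ψW : W → (Fin M → K) := W.domRestrict ψ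
  have hψW : Topology.IsClosedEmbedding ψW := hψ.isClosedEmbedding
  have key := card_le_topologicalKrullDim_closure_add H hH P F (fun a b ha hb hab => by
      obtain ⟨ha1, -, ha2, ha3⟩ := hgood a ha
      obtain ⟨hb1, -, hb2, hb3⟩ := hgood b hb
      have e1 : ψ (quotProj X ⟨σ a, ha1⟩) = ψ (quotProj X ⟨σ b, hb1⟩) := by
        rw [ha3, hb3]
        exact funext hab
      -- The chart is injective on `W`, so equal coordinates mean equal orbits. Comparing leading
      -- forms of the transform of `σ a` and of `σ b` then expresses `b` by `F`.
      have e2 : quotProj X ⟨σ b, hb1⟩ = quotProj X ⟨σ a, ha1⟩ :=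
        (congrArg Subtype.val (hψW.injective (a₁ := ⟨_, ha2⟩) (a₂ := ⟨_, hb2⟩) e1)).symm
      obtain ⟨g, hg⟩ := MulAction.orbitRel_apply.1 (Quotient.exact e2)
      have hg : g • σ a = σ b := congrArg Subtype.val hg
      obtain ⟨c, h', hh', e⟩ := hF g a _ (sub_form_mem hf)
      refine ⟨c, congrFun (form_eq_of_jet_eq hmk hh' (sub_form_mem hf) (e.symm.trans hg))⟩)
    (FractionRing (MvPolynomial (HomExp n m) K)) (S := ψW '' (Subtype.val ⁻¹' T)) (fun a ha => by
      obtain ⟨ha1, ha0, ha2, ha3⟩ := hgood a ha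
      exact ⟨⟨_, ha2⟩, ⟨_, ha0, rfl⟩, ha3⟩)
  rw [hψW.topologicalKrullDim_closure_eq] at key
  have h2 : topologicalKrullDim (closure (Subtype.val ⁻¹' T :
      Set W)) ≤ topologicalKrullDim (closure T) :=
    (Topology.IsInducing.subtypeVal.topologicalKrullDim_closure_le _).trans
      (topologicalKrullDim_closure_mono ((Set.image_preimage_subset _ _).trans subset_closure))
  exact (natCast_sub_le_dimToEReal (topologicalKrullDim (closure T)) (key.trans (by gcongr))).trans
    (le_iSup (fun i => setDim (quotProj (S.piece i) '' (Subtype.val ⁻¹' U))) i)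

theorem le_of_isJetModality {m k : ℕ} (hmk : m ≤ k) {f : MvPowerSeries (Fin n) K} (hf : f ∈ 𝔪 ^ m)
    (G : Type*) [Group G] [MulAction G (JetSpace n K k)] {κ : Type} [Finite κ]
    (F : HomExp n m → MvPolynomial (HomExp n m ⊕ κ) K) (hF : ActsOnLeadingForms G k F)
    {d : EReal} (hd : IsJetModality G (jet k f) d) :
    (((Nat.card (HomExp n m) : ℝ) - (Nat.card κ : ℝ) : ℝ) : EReal) ≤ d := by
  obtain ⟨S, rfl⟩ | rfl := hd
  · exact le_gMod hmk hf G F hF S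
  · exact le_gPar hmk hf G F hF

end Modality

/-! ### The right and contact groups act on leading forms. -/

section Group

variable {n : ℕ} {K : Type u} [Field K]

local notation "𝔪" => IsLocalRing.maximalIdeal (MvPowerSeries (Fin n) K)

theorem mem_maximalIdeal_pow_of_order_eq {f : MvPowerSeries (Fin n) K} {m : ℕ} (hm : f.order = m) :
    f ∈ 𝔪 ^ m :=
  mem_maximalIdeal_pow_iff.2 fun d hd => MvPowerSeries.coeff_of_lt_order (by
    rw [hm]; exact_mod_cast hd)

/-- If `k < m`, then `f` and `0` have the same `k`-jet, so determinacy puts `0` into the orbit of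
the nonzero series `f`. -/
theorem IsSufficientlyLarge.order_le {G : Type*} [Group G] [MulAction G (MvPowerSeries (Fin n) K)]
    (h0 : ∀ (g : G) (f : MvPowerSeries (Fin n) K), g • f = 0 → f = 0) {f : MvPowerSeries (Fin n) K}
    {m k : ℕ} (hm : f.order = m) (hk : IsSufficientlyLarge G f k) : m ≤ k := by
  by_contra! hlt
  obtain ⟨U, -, hfU, hdet⟩ := hk
  have hj : jet k 0 = jet k f := by
    rw [eq_comm, jet_eq_jet_iff, sub_zero]
    exact Ideal.pow_le_pow_right hlt (mem_maximalIdeal_pow_of_order_eq hm)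
  obtain ⟨g, hg⟩ := hdet f hfU 0 hj
  rw [h0 g f hg, MvPowerSeries.order_zero] at hm
  exact ENat.top_ne_natCast m hm

/-- For `m = 0`, the leading form is a constant, which is taken as a parameter. -/
theorem actsOnLeadingForms_zero (G : Type*) [Group G] (k : ℕ) [MulAction G (JetSpace n K k)]
    {κ : Type} (p : κ) : ActsOnLeadingForms (n := n) (K := K) (m :=
        0) G k fun _ => X (Sum.inr p) := by
  intro g a h hh
  obtain ⟨f, hf⟩ := jet_surjective k (g • jet k (form a + h))
  refine ⟨fun _ => MvPowerSeries.coeff 0 f, _, sub_form_mem (m := 0) (f := f) (by simp), ?_⟩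
  rw [← hf]
  have e : (fun d : HomExp n 0 => MvPowerSeries.coeff d.1 f) = fun d =>
      eval (Sum.elim a fun _ : κ => MvPowerSeries.coeff 0 f) (X (Sum.inr p)) := by
    ext d
    rw [(Finsupp.degree_eq_zero_iff d.1).1 d.2]
    simp
  rw [e, add_sub_cancel]

theorem actsOnLeadingForms_right (m k : ℕ) :
    ActsOnLeadingForms (RightGroup n K) k (substPoly n K m) := by
  intro Φ a h hh
  obtain ⟨g, hg⟩ := unit_mul_right_form (m := m) Φ 1 1 (by simp)
  obtain ⟨h', hh', e⟩ := hg a h hh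
  refine ⟨g, h', hh', ?_⟩
  rw [← e, one_mul]
  rfl

theorem actsOnLeadingForms_contact [IsAlgClosed K] {m : ℕ} (hm : 0 < m) (k : ℕ) :
    ActsOnLeadingForms (ContactGroup n K) k (substPoly n K m) := by
  intro γ a h hh
  obtain ⟨c, hc⟩ := IsAlgClosed.exists_pow_nat_eq
    (MvPowerSeries.constantCoeff (γ.left : MvPowerSeries (Fin n) K)) hm
  obtain ⟨g, hg⟩ := unit_mul_right_form (m := m) γ.right γ.left c hc.symm
  obtain ⟨h', hh', e⟩ := hg a h hh
  refine ⟨g, h', hh', ?_⟩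
  rw [← e, contact_smul_jet]
  rfl

theorem exists_actsOnLeadingForms [IsAlgClosed K] (hn : 1 ≤ n) (m k : ℕ) :
    ∃ F : HomExp n m → MvPolynomial (HomExp n m ⊕ (Fin n × Fin n)) K,
      ActsOnLeadingForms (ContactGroup n K) k F := by
  rcases Nat.eq_zero_or_pos m with rfl | hm
  · exact ⟨_, actsOnLeadingForms_zero _ k (⟨0, hn⟩, ⟨0, hn⟩)⟩
  · exact ⟨_, actsOnLeadingForms_contact hm k⟩

end Group

/-- Induction on `n`, with equality at `n = 3`. By Pascal's rule the right side grows by at least `2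
* (n + 2).choose 2 = (n + 2) * (n + 1)`, using `m ≥ 3`, while the left side grows by `4 * n + 2`. -/
theorem sq_add_le_two_mul_choose {n m : ℕ} (hn : 3 ≤ n) (hm : 3 ≤ m) :
    m ^ 2 + 3 * m + 2 * n ^ 2 ≤ 2 * (n + m - 1).choose m + 16 := by
  induction n, hn using Nat.le_induction with
  | base =>
    have h2 : (3 + m - 1).choose m = (m + 2).choose 2 := by
      rw [show 3 + m - 1 = m + 2 by omega, Nat.choose_symm_add]
    have h3 : 2 * (m + 2).choose 2 = (m + 2) * (m + 1) := by
      rw [Nat.choose_two_right, Nat.mul_div_cancel' (even_iff_two_dvd.1 (Nat.even_mul_pred_self _))]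
      rfl
    rw [h2]
    nlinarith
  | succ n hn ih =>
    obtain ⟨m, rfl⟩ : ∃ l, m = l + 1 := ⟨m - 1, by omega⟩
    have h1 : (n + 1 + (m + 1) - 1).choose (m + 1) = (n + m).choose m + (n + m).choose (m + 1) := by
      rw [show n + 1 + (m + 1) - 1 = n + m + 1 by omega, Nat.choose_succ_succ]
    have h2 : (n + 2).choose 2 ≤ (n + m).choose m := by
      rw [← Nat.choose_symm_add, ← Nat.choose_symm_add (a := n) (b := m)]
      exact Nat.choose_le_choose n (by omega)
    have h3 : 2 * (n + 2).choose 2 = (n + 2) * (n + 1) := by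
      rw [Nat.choose_two_right, Nat.mul_div_cancel' (even_iff_two_dvd.1 (Nat.even_mul_pred_self _))]
      rfl
    rw [show n + (m + 1) - 1 = n + m by omega] at ih
    rw [h1]
    nlinarith

end

theorem mainTheorem9 {K : Type*} [Field K] [IsAlgClosed K] {n : ℕ} (hn : 1 ≤ n)
    (f : MvPowerSeries (Fin n) K) (m : ℕ) (hm : f.order = m) (d : EReal)
    (hd : (milnorNumber f < ⊤ ∧ IsRightModality f d) ∨
      (tjurinaNumber f < ⊤ ∧ IsContactModality f d)) :
    (((((n + m - 1).choose m : ℝ) - (n : ℝ) ^ 2 : ℝ) : EReal) ≤ d) ∧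
    (n = 2 → (((m : ℝ) - 3 : ℝ) : EReal) ≤ d) ∧
    (3 ≤ n → 3 ≤ m → ((((m : ℝ) ^ 2 + 3 * m - 16) / 2 : ℝ) : EReal) ≤ d) := by
  have hf := mem_maximalIdeal_pow_of_order_eq hm
  have main : ((((n + m - 1).choose m : ℝ) - (n : ℝ) ^ 2 : ℝ) : EReal) ≤ d := by
    have hcard : (Nat.card (Fin n × Fin n) : ℝ) = (n : ℝ) ^ 2 := by
      simp [sq]
    rw [← card_homExp, ← hcard]
    rcases hd with ⟨-, k, hk, hd⟩ | ⟨-, k, hk, hd⟩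
    · exact le_of_isJetModality (hk.order_le (fun g f h => (map_eq_zero_iff g g.injective).1 h) hm)
        hf _ _ (actsOnLeadingForms_right m k) hd
    · obtain ⟨F, hF⟩ := exists_actsOnLeadingForms (K := K) hn m k
      exact le_of_isJetModality (hk.order_le (fun g f h =>
          (map_eq_zero_iff g.right g.right.injective).1
        ((Units.mul_right_eq_zero g.left).1 h)) hm) hf _ F hF hd
  refine ⟨main, fun h2 => le_trans ?_ main, fun h3 hm3 => le_trans ?_ main⟩
  · subst h2
    -- For two variables the bound is `(m + 1) - 4`.
    rw [EReal.coe_le_coe_iff, show 2 + m - 1 = m + 1 by omega, Nat.choose_succ_self_right]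
    push_cast
    linarith
  · rw [EReal.coe_le_coe_iff]
    have h : ((m ^ 2 + 3 * m + 2 * n ^ 2 : ℕ) : ℝ) ≤ ((2 * (n + m - 1).choose m + 16 : ℕ) : ℝ) :=
      Nat.cast_le.2 (sq_add_le_two_mul_choose h3 hm3)
    push_cast at h
    linarith
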